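/- **Setting.** For metric spaces $X,Y$ with Borel probability measures $\mu,\nu$ (mm-spaces) and groups $G$, $H$ acting on $X$, $Y$ by measure-preserving isometries, define the equivariant box distance as follows. For $\gamma\in X^X\sqcup Y^Y$ put $f_\gamma((x_1,y_1),(x_2,y_2))=d_X(\gamma x_1,x_2)$ if $\gamma\in X^X$ and $=d_Y(\gamma y_1,y_2)$ if $\gamma\in Y^Y$. For $S\subset X\times Y$ let $d^S(\gamma_1,\gamma_2)=\sup_{S\times S}|f_{\gamma_1}-f_{\gamma_2}|$ (with $d^\emptyset=0$), and for a coupling $\pi$ of $\mu$ and $\nu$ let $d^\pi(\gamma_1,\gamma_2)=\inf_S\max\{1-\pi(S),d^S(\gamma_1,\gamma_2)\}$, where $S$ runs over the closed subsets of $\operatorname{supp}\pi$. Then $\square((X,G),(Y,H))$ is the infimum over all couplings $\pi$ of the Hausdorff distance, with respect to $d^\pi$, between $G$ and $H$ (regarded as sets of self-maps of $X$ and of $Y$), and $\square(X,Y)=\square((X,\{\mathrm{id}\}),(Y,\{\mathrm{id}\}))$. Equivariant box convergence and box convergence mean convergence of these distances to $0$. A quotient $X/G$ carries the distance between orbits and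 the push-forward of $\mu$. For $j=1,2,\dots$ let $n(j)\ge 1$ be integers with $n(j)\to\infty$, let $\alpha_{ij}>0$ $(1\le i\le n(j))$, and let $$E_j=\Big\{z\in\mathbb C^{n(j)} : \sum_{i=1}^{n(j)}\frac{|z_i|^2}{\alpha_{ij}^2}=1\Big\},$$ with the Euclidean distance and the push-forward of the normalized volume measure of the unit sphere $S^{2n(j)-1}\subset\mathbb C^{n(j)}$ by the linear map $z\mapsto(\alpha_{ij}z_i)_i$. Put $a_{ij}=\alpha_{ij}/\sqrt{2n(j)}$. Let $a_1,a_2,\dots$ be real numbers with $\sum_i a_i^2<\infty$, and let $\Gamma^\infty_{\{a_i\}}$ be the Hilbert space $H$ of square-summable complex sequences with its norm distance and the Gaussian measure $\bigotimes_{i\ge1}(\gamma^1_{a_i^2}\otimes\gamma^1_{a_i^2})$, where $\gamma^1_{s^2}$ is the centered Gaussian measure on $\mathbb R$ of variance $s^2$ (the real and imaginary parts of the $i$-th coordinate are independent of variance $a_i^2$). The group $U(1)$ acts on $H$ and on each $E_j$ by scalar multiplication (Hopf action), and $\mathbb Z_j=\mathbb Z/j\mathbb Z$ acts on $E_j$ through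 $[k]\mapsto e^{2\pi\sqrt{-1}\,k/j}\in U(1)$; the quotients $E_j/\mathbb Z_j$ are lens spaces. **Theorem.** If $\lim_{j\to\infty}\sum_{i=1}^{n(j)}(a_{ij}-a_i)^2=0$, then as $j\to\infty$: 1. $(E_j,\mathbb Z_j)$ equivariantly box-converges to $(\Gamma^\infty_{\{a_i\}},U(1))$. 2. $E_j/\mathbb Z_j$ box-converges to $\Gamma^\infty_{\{a_i\}}/U(1)$. Moreover, as a metric space, $\Gamma^\infty_{\{a_i\}}/U(1)=H/U(1)$ is the Euclidean cone over the infinite-dimensional complex projective space $\mathbb{CP}^\infty=\mathbb P(H)$ with the Fubini–Study distance $d([u],[v])=\arccos\frac{|\langle u,v\rangle|}{\|u\|\,\|v\|}$: there is a surjection $q:[0,\infty)\times\mathbb P(H)\to H/U(1)$ collapsing exactly $\{0\}\times\mathbb P(H)$ to one point, otherwise injective, with $d(q(r,x),q(s,y))^2=r^2+s^2-2rs\cos d(x,y)$. -/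

import Mathlib

open MeasureTheory ProbabilityTheory Filter Topology
open scoped ENNReal NNReal

noncomputable section

namespace EquivBox

/-! ### The equivariant box distance -/

section Box

variable {X Y : Type*} [PseudoMetricSpace X] [MeasurableSpace X]
  [PseudoMetricSpace Y] [MeasurableSpace Y]

/-- The set `Π(X, Y)` of couplings (transport plans) between `μ` and `ν`. -/
def couplings (μ : Measure X) (ν : Measure Y) : Set (Measure (X × Y)) :=
  {π | π.map Prod.fst = μ ∧ π.map Prod.snd = ν}

/-- For `γ` in the disjoint union of `X^X` and `Y^Y`, the function
`f_γ((x₁, y₁), (x₂, y₂))`, equal to `d_X (γ x₁, x₂)` if `γ : X → X`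
and to `d_Y (γ y₁, y₂)` if `γ : Y → Y`. -/
def displacement (γ : (X → X) ⊕ (Y → Y)) (p q : X × Y) : ℝ :=
  match γ with
  | Sum.inl g => dist (g p.1) q.1
  | Sum.inr h => dist (h p.2) q.2

/-- `d^S(γ₁, γ₂) = sup_{S × S} |f_{γ₁} - f_{γ₂}|`, with value `0` for `S = ∅`. -/
def distOn (S : Set (X × Y)) (γ₁ γ₂ : (X → X) ⊕ (Y → Y)) : ℝ≥0∞ :=
  ⨆ p ∈ S, ⨆ q ∈ S, ENNReal.ofReal |displacement γ₁ p q - displacement γ₂ p q|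

/-- `d^π(γ₁, γ₂) = inf_S max {1 - π(S), d^S(γ₁, γ₂)}`, where `S` runs over the closed subsets
of the support of `π`. -/
def distPlan (π : Measure (X × Y)) (γ₁ γ₂ : (X → X) ⊕ (Y → Y)) : ℝ≥0∞ :=
  ⨅ (S : Set (X × Y)) (_ : IsClosed S) (_ : S ⊆ π.support), max (1 - π S) (distOn S γ₁ γ₂)

/-- The Hausdorff distance between two subsets `A`, `B` with respect to an extended
pseudo-metric `d`. -/
def hausdorffDistWith {T : Type*} (d : T → T → ℝ≥0∞) (A B : Set T) : ℝ≥0∞ :=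
  max (⨆ a ∈ A, ⨅ b ∈ B, d a b) (⨆ b ∈ B, ⨅ a ∈ A, d a b)

/-- The equivariant box distance between `(X, μ, G)` and `(Y, ν, H)`: the infimum over all
couplings `π` of the Hausdorff distance between `G` and `H` with respect to `d^π`.
The groups are regarded as sets of self-maps of `X` and of `Y`. -/
def eqBoxDist (μ : Measure X) (G : Set (X → X)) (ν : Measure Y) (H : Set (Y → Y)) : ℝ≥0∞ :=
  ⨅ π ∈ couplings μ ν, hausdorffDistWith (distPlan π) (Sum.inl '' G) (Sum.inr '' H)

/-- The box distance between `(X, μ)` and `(Y, ν)`: the case of trivial groups. -/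
def boxDist (μ : Measure X) (ν : Measure Y) : ℝ≥0∞ :=
  eqBoxDist μ {id} ν {id}

end Box

/-! ### Group actions and quotient spaces -/

/-- The self-maps of `X` given by the elements of a group acting on `X`. -/
def actionMaps (G X : Type*) [Group G] [MulAction G X] : Set (X → X) :=
  Set.range fun (g : G) (x : X) => g • x

/-- The quotient `X / G`, i.e. the set of orbits. -/
def OrbitSpace (G X : Type*) [Group G] [MulAction G X] : Type _ :=
  MulAction.orbitRel.Quotient G X

section Orbit

variable (G : Type*) {X : Type*} [Group G] [MulAction G X]

/-- The quotient map `X → X / G`. -/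
def OrbitSpace.mk (x : X) : OrbitSpace G X :=
  Quotient.mk (MulAction.orbitRel G X) x

variable {G}

theorem OrbitSpace.mk_eq_mk_iff {x y : X} :
    OrbitSpace.mk G x = OrbitSpace.mk G y ↔ ∃ g : G, g • y = x :=
  Quotient.eq (r := MulAction.orbitRel G X)

theorem OrbitSpace.mk_surjective : Function.Surjective (OrbitSpace.mk G : X → OrbitSpace G X) :=
  Quotient.mk_surjective

variable [PseudoMetricSpace X]

/-- All distances between a point of the orbit `p` and a point of the orbit `q`. -/
def OrbitSpace.distSet (p q : OrbitSpace G X) : Set ℝ :=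
  {r | ∃ x y : X, OrbitSpace.mk G x = p ∧ OrbitSpace.mk G y = q ∧ r = dist x y}

theorem OrbitSpace.distSet_nonempty (p q : OrbitSpace G X) :
    (OrbitSpace.distSet p q).Nonempty := by
  obtain ⟨x, rfl⟩ := OrbitSpace.mk_surjective p
  obtain ⟨y, rfl⟩ := OrbitSpace.mk_surjective q
  exact ⟨_, x, y, rfl, rfl, rfl⟩

theorem OrbitSpace.distSet_bddBelow (p q : OrbitSpace G X) :
    BddBelow (OrbitSpace.distSet p q) :=
  ⟨0, by rintro r ⟨x, y, -, -, rfl⟩; exact dist_nonneg⟩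

/-- The quotient metric on `X / G` for an isometric action: the distance between orbits. -/
instance OrbitSpace.instPseudoMetricSpace [IsIsometricSMul G X] :
    PseudoMetricSpace (OrbitSpace G X) where
  dist p q := sInf (OrbitSpace.distSet p q)
  dist_self p := by
    obtain ⟨x, rfl⟩ := OrbitSpace.mk_surjective p
    refine le_antisymm ?_ ?_
    · exact csInf_le (OrbitSpace.distSet_bddBelow _ _) ⟨x, x, rfl, rfl, (dist_self x).symm⟩
    · refine Real.sInf_nonneg ?_
      rintro r ⟨x, y, -, -, rfl⟩
      exact dist_nonneg
  dist_comm p q := by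
    congr 1
    ext r
    constructor
    · rintro ⟨x, y, hx, hy, rfl⟩
      exact ⟨y, x, hy, hx, dist_comm x y⟩
    · rintro ⟨x, y, hx, hy, rfl⟩
      exact ⟨y, x, hy, hx, dist_comm x y⟩
  dist_triangle p q s := by
    refine le_of_forall_pos_le_add fun ε hε => ?_
    obtain ⟨_, ⟨x, y, hx, hy, rfl⟩, h1⟩ :=
      Real.lt_sInf_add_pos (OrbitSpace.distSet_nonempty p q) (half_pos hε)
    obtain ⟨_, ⟨y', z, hy', hz, rfl⟩, h2⟩ :=
      Real.lt_sInf_add_pos (OrbitSpace.distSet_nonempty q s) (half_pos hε)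
    obtain ⟨g, hg⟩ := OrbitSpace.mk_eq_mk_iff.1 (hy.trans hy'.symm)
    have h3 : sInf (OrbitSpace.distSet p s) ≤ dist x (g • z) :=
      csInf_le (OrbitSpace.distSet_bddBelow p s)
        ⟨x, g • z, hx, (OrbitSpace.mk_eq_mk_iff.2 ⟨g, rfl⟩).trans hz, rfl⟩
    have h4 : dist x (g • z) ≤ dist x y + dist y' z := by
      calc dist x (g • z) ≤ dist x y + dist y (g • z) := dist_triangle _ _ _
        _ = dist x y + dist y' z := by rw [← hg, dist_smul]
    linarith

instance OrbitSpace.instMeasurableSpace [IsIsometricSMul G X] :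
    MeasurableSpace (OrbitSpace G X) := borel _

instance OrbitSpace.instBorelSpace [IsIsometricSMul G X] : BorelSpace (OrbitSpace G X) := ⟨rfl⟩

/-- The measure of `X / G`: the push-forward of `μ` by the quotient map. -/
def orbitMeasure (G : Type*) {X : Type*} [Group G] [MulAction G X] [PseudoMetricSpace X]
    [IsIsometricSMul G X] [MeasurableSpace X] (μ : Measure X) : Measure (OrbitSpace G X) :=
  μ.map (OrbitSpace.mk G)

end Orbit

/-! ### Hopf actions -/

theorem circle_isIsometricSMul {V : Type*} [NormedAddCommGroup V] [NormedSpace ℂ V] :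
    IsIsometricSMul Circle V :=
  ⟨fun c => Isometry.of_dist_eq fun x y => by
    simp [Circle.smul_def, dist_eq_norm, ← smul_sub, norm_smul, Circle.norm_coe]⟩

instance subgroup_isIsometricSMul {M X : Type*} [Group M] [MulAction M X] [PseudoEMetricSpace X]
    [IsIsometricSMul M X] (S : Subgroup M) : IsIsometricSMul S X :=
  ⟨fun c => isometry_smul X (c : M)⟩

/-- The image of `ℤ/jℤ` in `U(1)` under `[k] ↦ exp (2 π i k / j)`. -/
def cyclicSubgroup (j : ℕ) [NeZero j] : Subgroup Circle :=
  (AddChar.toMonoidHom (ZMod.toCircle : AddChar (ZMod j) Circle)).range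

/-! ### Complex ellipsoids -/

/-- The ellipsoid `{z ∈ ℂⁿ | ∑ |zᵢ|² / αᵢ² = 1}`, with the Euclidean distance. -/
def Ellipsoid {n : ℕ} (α : Fin n → ℝ) : Type :=
  {z : EuclideanSpace ℂ (Fin n) // ∑ i, ‖z i‖ ^ 2 / α i ^ 2 = 1}

section Ellipsoid

variable {n : ℕ} (α : Fin n → ℝ)

instance : MetricSpace (Ellipsoid α) := inferInstanceAs (MetricSpace (Subtype _))

instance : MeasurableSpace (Ellipsoid α) := borel _

instance : BorelSpace (Ellipsoid α) := ⟨rfl⟩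

/-- The Hopf action of `U(1)` on an ellipsoid, by scalar multiplication. -/
instance : MulAction Circle (Ellipsoid α) where
  smul c z := ⟨c • z.1, by simpa [Circle.smul_def, Circle.norm_coe] using z.2⟩
  one_smul z := Subtype.ext (one_smul Circle z.1)
  mul_smul c c' z := Subtype.ext (mul_smul c c' z.1)

instance : IsIsometricSMul Circle (Ellipsoid α) :=
  ⟨fun c => Isometry.of_dist_eq fun x y =>
    (circle_isIsometricSMul (V := EuclideanSpace ℂ (Fin n))).isometry_smul c |>.dist_eq x.1 y.1⟩

/-- The normalized volume measure on the unit sphere of `ℂⁿ`. -/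
def sphereMeasure (n : ℕ) : Measure (Metric.sphere (0 : EuclideanSpace ℂ (Fin n)) 1) :=
  let σ := (volume : Measure (EuclideanSpace ℂ (Fin n))).toSphere
  (σ Set.univ)⁻¹ • σ

variable {α}

/-- The restriction to the unit sphere of the linear map `z ↦ (αᵢ zᵢ)ᵢ`. -/
def ellipsoidMap (hα : ∀ i, 0 < α i) (z : Metric.sphere (0 : EuclideanSpace ℂ (Fin n)) 1) :
    Ellipsoid α :=
  ⟨WithLp.toLp 2 fun i => (α i : ℂ) * z.1 i, by
    have hz : ∑ i, ‖z.1 i‖ ^ 2 = 1 := by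
      rw [← EuclideanSpace.norm_sq_eq, norm_eq_of_mem_sphere, one_pow]
    refine (Finset.sum_congr rfl fun i _ => ?_).trans hz
    have := (hα i).ne'
    simp only [norm_mul, Complex.norm_real, Real.norm_eq_abs, mul_pow, sq_abs]
    field_simp⟩

/-- The measure of an ellipsoid: the push-forward of the normalized volume measure on the unit
sphere by the linear map `z ↦ (αᵢ zᵢ)ᵢ`. -/
def ellipsoidMeasure (hα : ∀ i, 0 < α i) : Measure (Ellipsoid α) :=
  (sphereMeasure n).map (ellipsoidMap hα)

end Ellipsoid

/-! ### The infinite-dimensional Gaussian space -/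

/-- The Hilbert space of square-summable complex sequences. -/
abbrev HilbertSeq : Type := lp (fun _ : ℕ => ℂ) 2

instance : MeasurableSpace HilbertSeq := borel _

instance : BorelSpace HilbertSeq := ⟨rfl⟩

instance : IsIsometricSMul Circle HilbertSeq := circle_isIsometricSMul

/-- The Gaussian measure on `ℂ = ℝ²` whose real and imaginary parts are independent, centered, of
variance `s²`. -/
def complexGaussian (s : ℝ) : Measure ℂ :=
  ((gaussianReal 0 (Real.toNNReal (s ^ 2))).prod (gaussianReal 0 (Real.toNNReal (s ^ 2)))).map
    Complex.measurableEquivRealProd.symm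

instance (s : ℝ) : IsProbabilityMeasure (complexGaussian s) :=
  Measure.isProbabilityMeasure_map Complex.measurableEquivRealProd.symm.measurable.aemeasurable

/-- The measure of the Gaussian space with parameters `a`: the restriction to the Hilbert space of
square-summable sequences of the infinite product, on `ℂ^ℕ`, of the Gaussian measures with
variances `aᵢ²`. -/
def gaussianMeasure (a : ℕ → ℝ) : Measure HilbertSeq :=
  (Measure.infinitePi fun i => complexGaussian (a i)).comap fun z i => z i

/-! ### Cones and the projective space -/

/-- The Fubini–Study distance `arccos (|⟨u, v⟩| / (‖u‖ ‖v‖))` on the projective space of a complex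
inner product space. -/
def fubiniStudyDist {V : Type*} [NormedAddCommGroup V] [InnerProductSpace ℂ V]
    (p q : Projectivization ℂ V) : ℝ :=
  Real.arccos (‖inner ℂ p.rep q.rep‖ / (‖p.rep‖ * ‖q.rep‖))

/-- `q : [0, ∞) × Y → C` exhibits `C` as the Euclidean cone over `Y` with the distance `d`:
it is onto, it collapses exactly `{0} × Y`, to the apex, and distances in `C` are given by the law
of cosines. -/
structure IsEuclideanCone {Y C : Type*} [PseudoMetricSpace C] (d : Y → Y → ℝ)
    (q : ℝ≥0 × Y → C) : Prop where
  surjective : Function.Surjective q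
  eq_iff : ∀ x y, q x = q y ↔ x.1 = y.1 ∧ (x.1 = 0 ∨ x.2 = y.2)
  dist_eq : ∀ x y, dist (q x) (q y) =
    √((x.1 : ℝ) ^ 2 + (y.1 : ℝ) ^ 2 - 2 * x.1 * y.1 * Real.cos (min (d x.2 y.2) Real.pi))

end EquivBox

end

open EquivBox

/-!
The ellipsoid `E_j` and the Gaussian space are both realized on one probability space, the law of
a sequence `ω` of independent standard complex Gaussian variables. The point `(aᵢ ωᵢ)ᵢ` of `ℓ²` has
the law of the Gaussian space (`map_scaledSeq`). Standard Gaussian measure on `ℂⁿ` has a radial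
density, so the direction of `(ω₀, …, ω_{n-1})` is uniform on the sphere, and its image under the
linear map with coefficients `αᵢ` has the law of the ellipsoid (`map_ellipsoidPoint`). In `ℓ²`, this
second point is the sequence with Gaussian coordinates of standard deviations `αᵢ / √(2n)`,
multiplied by the ratio of `√(2n)` to the norm of `(ω₀, …, ω_{n-1})`. The ratio tends to `1`
by the law of large numbers, and the sequence tends to `(aᵢ ωᵢ)ᵢ` in mean square by the hypothesis
on the semi-axes. Hence the two points are close outside an event of small probability
(`exists_radius_eventually_measure_le`).

Since the inclusion of `E_j` in `ℓ²` is isometric and commutes with scalars, closeness of the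
points in `ℓ²` controls all the displacement functions at once: two rotations `c`, `c'` that differ
by at most `δ` move a vector of norm at most `R` to points at distance at most `δ R`, and the group
`ℤ/jℤ` is `2π/j`-dense in `U(1)`. Taking the infimum over rotations gives the same estimate for the
distances between orbits. So the same coupling proves both convergence statements
(`eqBoxDist_map_le`, `boxDist_orbitMeasure_map_le`).

Finally, `‖c z - w‖² = ‖z‖² + ‖w‖² - 2 Re ⟪c z, w⟫` is smallest over `|c| = 1` when `⟪c z, w⟫` is the
real number `|⟪z, w⟫|`; this is the law of cosines for the Fubini–Study distance
(`isEuclideanCone_coneMap`).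
-/

/-! ### The direction of a rotation-invariant random vector -/

section Direction

variable {E : Type*} [NormedAddCommGroup E] [NormedSpace ℝ E]

/-- The direction `x / ‖x‖` of a vector `x`, with the arbitrary value `e` at `x = 0`. -/
noncomputable def direction (e : Metric.sphere (0 : E) 1) (x : E) : Metric.sphere (0 : E) 1 :=
  open scoped Classical in if h : x ∈ ({0}ᶜ : Set E) then (homeomorphUnitSphereProd E ⟨x, h⟩).1 else e

theorem coe_direction (e : Metric.sphere (0 : E) 1) {x : E} (hx : x ≠ 0) :
    (direction e x : E) = ‖x‖⁻¹ • x := by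
  have h : x ∈ ({0}ᶜ : Set E) := hx
  simp only [direction, h, dif_pos]
  rw [homeomorphUnitSphereProd_apply_fst_coe]

variable [MeasurableSpace E] [BorelSpace E]

theorem measurable_direction (e : Metric.sphere (0 : E) 1) : Measurable (direction e) := by
  classical
  exact Measurable.dite (f := fun x => (homeomorphUnitSphereProd E x).1)
    (continuous_fst.comp (homeomorphUnitSphereProd E).continuous).measurable measurable_const
    (measurableSet_singleton (0 : E)).compl

/-- If a probability measure has a radial density with respect to a Haar measure, then its
direction is uniformly distributed on the unit sphere: in polar coordinates it is a product
measure. -/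
theorem map_direction_withDensity [FiniteDimensional ℝ E] [Nontrivial E] (μ : Measure E)
    [μ.IsAddHaarMeasure] {f : ℝ → ℝ≥0∞} (hf : Measurable f)
    [IsProbabilityMeasure (μ.withDensity fun x => f ‖x‖)] (e : Metric.sphere (0 : E) 1) :
    (μ.withDensity fun x => f ‖x‖).map (direction e) =
      (μ.toSphere Set.univ)⁻¹ • μ.toSphere := by
  set K : ℝ≥0∞ := ∫⁻ r : Set.Ioi (0 : ℝ), f r ∂Measure.volumeIoiPow (Module.finrank ℝ E - 1)
  have key : ∀ s, MeasurableSet s →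
      (μ.withDensity fun x => f ‖x‖) (direction e ⁻¹' s) = μ.toSphere s * K := by
    intro s hs
    have hm := measurable_direction e hs
    rw [withDensity_apply _ hm, ← lintegral_indicator hm]
    have h0 : (∫⁻ x, (direction e ⁻¹' s).indicator (fun x => f ‖x‖) x ∂μ) =
        ∫⁻ x : ({(0)}ᶜ : Set E), (direction e ⁻¹' s).indicator (fun x => f ‖x‖) x
          ∂(μ.comap (↑)) := by
      rw [lintegral_subtype_comap (measurableSet_singleton _).compl,
        restrict_compl_singleton]
    have h1 : ∀ x : ({(0)}ᶜ : Set E), (direction e ⁻¹' s).indicator (fun x => f ‖x‖) (x : E) =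
        (fun p : Metric.sphere (0 : E) 1 × Set.Ioi (0 : ℝ) =>
          s.indicator (1 : Metric.sphere (0 : E) 1 → ℝ≥0∞) p.1 * f p.2) (homeomorphUnitSphereProd E x) := by
      intro x
      have hd : direction e (x : E) = (homeomorphUnitSphereProd E x).1 := by
        simp only [direction, x.2, dif_pos, Subtype.coe_eta]
      by_cases hx : direction e (x : E) ∈ s
      · rw [Set.indicator_of_mem (by exact hx)]
        rw [hd] at hx
        simp [hx]
      · rw [Set.indicator_of_notMem (by exact hx)]
        rw [hd] at hx
        simp [hx]
    rw [h0, lintegral_congr h1]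
    have h2 := (μ.measurePreserving_homeomorphUnitSphereProd).lintegral_comp_emb
      (Homeomorph.measurableEmbedding _) (fun p : Metric.sphere (0 : E) 1 × Set.Ioi (0 : ℝ) =>
          s.indicator (1 : Metric.sphere (0 : E) 1 → ℝ≥0∞) p.1 * f p.2)
    refine h2.trans ?_
    rw [lintegral_prod_mul (f := s.indicator (1 : Metric.sphere (0 : E) 1 → ℝ≥0∞))
        (g := fun r : Set.Ioi (0 : ℝ) => f r) ((measurable_one.indicator hs).aemeasurable)
        (by fun_prop), lintegral_indicator_one hs]
  have h1 : μ.toSphere Set.univ * K = 1 := by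
    rw [← key _ MeasurableSet.univ, Set.preimage_univ, measure_univ]
  ext s hs
  rw [Measure.map_apply (measurable_direction e) hs, key s hs, Measure.smul_apply, smul_eq_mul,
    ENNReal.eq_inv_of_mul_eq_one_left ((mul_comm _ _).trans h1), mul_comm]

end Direction

/-! ### Densities of finite products -/

theorem lintegral_fin_prod_eq_prod {n : ℕ} {E : Fin n → Type*}
    {mE : ∀ i, MeasurableSpace (E i)} {μ : (i : Fin n) → Measure (E i)} [∀ i, SigmaFinite (μ i)]
    {f : (i : Fin n) → E i → ℝ≥0∞} (hf : ∀ i, Measurable (f i)) :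
    ∫⁻ x : (i : Fin n) → E i, ∏ i, f i (x i) ∂(Measure.pi μ) = ∏ i, ∫⁻ x, f i x ∂(μ i) := by
  induction n with
  | zero => simp
  | succ n ih =>
    calc
      _ = ∫⁻ x : E 0 × ((i : Fin n) → E (Fin.succ i)),
          f 0 x.1 * ∏ i : Fin n, f (Fin.succ i) (x.2 i)
          ∂((μ 0).prod (Measure.pi (fun i ↦ μ i.succ))) := by
        rw [← ((measurePreserving_piFinSuccAbove μ 0).symm).lintegral_comp_emb
          (MeasurableEquiv.measurableEmbedding _)]
        simp_rw [MeasurableEquiv.piFinSuccAbove_symm_apply, Fin.insertNthEquiv,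
          Fin.prod_univ_succ, Fin.insertNth_zero]
        rfl
      _ = (∫⁻ x, f 0 x ∂μ 0)
          * ∏ i : Fin n, ∫⁻ (x : E (Fin.succ i)), f (Fin.succ i) x ∂(μ i.succ) := by
        rw [← ih fun i => hf _]
        exact lintegral_prod_mul (hf 0).aemeasurable
          (Finset.measurable_prod _ fun i _ => (hf _).comp (measurable_pi_apply i)).aemeasurable
      _ = ∏ i, ∫⁻ x, f i x ∂(μ i) := by rw [Fin.prod_univ_succ]

theorem pi_withDensity {n : ℕ} {E : Fin n → Type*}
    {mE : ∀ i, MeasurableSpace (E i)} {μ : (i : Fin n) → Measure (E i)} [∀ i, SigmaFinite (μ i)]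
    {f : (i : Fin n) → E i → ℝ≥0∞} (hf : ∀ i, Measurable (f i))
    [∀ i, SigmaFinite ((μ i).withDensity (f i))] :
    Measure.pi (fun i => (μ i).withDensity (f i)) =
      (Measure.pi μ).withDensity fun x => ∏ i, f i (x i) := by
  refine Measure.pi_eq fun s hs => ?_
  rw [withDensity_apply _ (MeasurableSet.univ_pi hs), ← lintegral_indicator (.univ_pi hs)]
  have : (Set.univ.pi s).indicator (fun x : (i : Fin n) → E i => ∏ i, f i (x i)) =
      fun x => ∏ i, (s i).indicator (f i) (x i) := by
    classical
    funext x
    by_cases hx : x ∈ Set.univ.pi s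
    · rw [Set.indicator_of_mem hx]
      exact Finset.prod_congr rfl fun i _ => (Set.indicator_of_mem (hx i trivial) _).symm
    · rw [Set.indicator_of_notMem hx]
      simp only [Set.mem_univ_pi, not_forall] at hx
      obtain ⟨i, hi⟩ := hx
      exact (Finset.prod_eq_zero (Finset.mem_univ i) (Set.indicator_of_notMem hi _)).symm
  rw [this, lintegral_fin_prod_eq_prod fun i => (hf i).indicator (hs i)]
  exact Finset.prod_congr rfl fun i _ => by
    rw [lintegral_indicator (hs i), withDensity_apply _ (hs i)]

/-! ### Complex Gaussian measures -/

theorem complexGaussian_one_eq_withDensity :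
    complexGaussian 1 = volume.withDensity fun z : ℂ =>
      ENNReal.ofReal ((2 * Real.pi)⁻¹ * Real.exp (-‖z‖ ^ 2 / 2)) := by
  have h1 : Real.toNNReal ((1 : ℝ) ^ 2) = 1 := by simp
  rw [complexGaussian, h1, gaussianReal_of_var_ne_zero 0 one_ne_zero,
    prod_withDensity (measurable_gaussianPDF _ _) (measurable_gaussianPDF _ _)]
  have hv := Complex.volume_preserving_equiv_real_prod.symm.map_eq
  ext s hs
  rw [MeasurableEquiv.map_apply, withDensity_apply _
    (Complex.measurableEquivRealProd.symm.measurable hs), withDensity_apply _ hs,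
    ← Complex.volume_preserving_equiv_real_prod.symm.setLIntegral_comp_preimage_emb
      (MeasurableEquiv.measurableEmbedding _)]
  refine lintegral_congr fun p => ?_
  rw [gaussianPDF, gaussianPDF, ← ENNReal.ofReal_mul (gaussianPDFReal_nonneg _ _ _)]
  congr 1
  rw [← Complex.normSq_eq_norm_sq, gaussianPDFReal, gaussianPDFReal, mul_mul_mul_comm,
    ← Real.exp_add, Complex.normSq_apply]
  congr 1
  · rw [← mul_inv, NNReal.coe_one, mul_one, Real.mul_self_sqrt (by positivity)]
  · congr 1
    simp [Complex.measurableEquivRealProd_symm_apply]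
    ring

theorem map_mul_complexGaussian_one (s : ℝ) :
    (complexGaussian 1).map (fun z => (s : ℂ) * z) = complexGaussian s := by
  have hg : (gaussianReal 0 1).map (fun x => s * x) = gaussianReal 0 (Real.toNNReal (s ^ 2)) := by
    rw [gaussianReal_map_const_mul, mul_zero, mul_one]
    congr 1
    ext
    simp [sq_nonneg]
  have h1 : Real.toNNReal ((1 : ℝ) ^ 2) = 1 := by simp
  rw [complexGaussian, complexGaussian, h1, ← hg,
    Measure.map_prod_map _ _ (by fun_prop) (by fun_prop),
    Measure.map_map (by fun_prop) (MeasurableEquiv.measurable _),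
    Measure.map_map (MeasurableEquiv.measurable _) (by fun_prop)]
  congr 1
  funext p
  apply Complex.ext <;> simp [Complex.measurableEquivRealProd_symm_apply]

theorem integrable_sq_and_integral_sq_gaussianReal :
    Integrable (fun x : ℝ => x ^ 2) (gaussianReal 0 1) ∧
      ∫ x, x ^ 2 ∂(gaussianReal 0 1) = 1 := by
  refine ⟨?_, ?_⟩
  · exact (memLp_id_gaussianReal' (μ := 0) (v := 1) 2 (by simp)).integrable_sq
  · have h := variance_fun_id_gaussianReal (μ := 0) (v := 1)
    rw [variance_of_integral_eq_zero (by fun_prop) (by simp)] at h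
    simpa using h

theorem norm_sq_measurableEquivRealProd_symm (p : ℝ × ℝ) :
    ‖Complex.measurableEquivRealProd.symm p‖ ^ 2 = p.1 ^ 2 + p.2 ^ 2 := by
  rw [← Complex.normSq_eq_norm_sq, Complex.normSq_apply,
    Complex.measurableEquivRealProd_symm_apply]
  ring

theorem integrable_norm_sq_complexGaussian_one :
    Integrable (fun z : ℂ => ‖z‖ ^ 2) (complexGaussian 1) := by
  have h1 : Real.toNNReal ((1 : ℝ) ^ 2) = 1 := by simp
  have hi := integrable_sq_and_integral_sq_gaussianReal.1
  rw [complexGaussian, h1, (MeasurableEquiv.measurableEmbedding _).integrable_map_iff]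
  refine ((hi.comp_fst (gaussianReal 0 1)).add (hi.comp_snd (gaussianReal 0 1))).congr
    (ae_of_all _ fun p => ?_)
  simp only [Function.comp_apply, norm_sq_measurableEquivRealProd_symm, Pi.add_apply]

theorem integral_norm_sq_complexGaussian_one :
    ∫ z, ‖z‖ ^ 2 ∂(complexGaussian 1) = 2 := by
  have h1 : Real.toNNReal ((1 : ℝ) ^ 2) = 1 := by simp
  obtain ⟨hi, he⟩ := integrable_sq_and_integral_sq_gaussianReal
  rw [complexGaussian, h1, (MeasurableEquiv.measurableEmbedding _).integral_map]
  simp_rw [norm_sq_measurableEquivRealProd_symm]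
  rw [integral_add (hi.comp_fst _) (hi.comp_snd _), integral_fun_fst (fun x : ℝ => x ^ 2),
    integral_fun_snd (fun x : ℝ => x ^ 2), he]
  norm_num

theorem lintegral_norm_sq_complexGaussian_one :
    ∫⁻ z, ENNReal.ofReal (‖z‖ ^ 2) ∂(complexGaussian 1) = 2 := by
  rw [← ofReal_integral_eq_lintegral_ofReal integrable_norm_sq_complexGaussian_one
    (ae_of_all _ fun _ => by positivity), integral_norm_sq_complexGaussian_one]
  simp

/-- The direction of a standard Gaussian vector in `ℂⁿ` is uniformly distributed on the unit
sphere. -/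
theorem map_direction_pi_complexGaussian {n : ℕ}
    (e : Metric.sphere (0 : EuclideanSpace ℂ (Fin n)) 1) :
    (Measure.pi fun _ : Fin n => complexGaussian 1).map (fun z => direction e (WithLp.toLp 2 z)) =
      sphereMeasure n := by
  have : Nontrivial (EuclideanSpace ℂ (Fin n)) :=
    nontrivial_of_ne _ _ (ne_zero_of_mem_unit_sphere e)
  set L := EuclideanSpace.equiv (Fin n) ℂ
  set f : ℝ → ℝ≥0∞ := fun r => ENNReal.ofReal ((2 * Real.pi)⁻¹ ^ n * Real.exp (-r ^ 2 / 2))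
  have hf : Measurable f := by fun_prop
  set ν : Measure (EuclideanSpace ℂ (Fin n)) :=
    (Measure.pi fun _ : Fin n => complexGaussian 1).map (WithLp.toLp 2) with hν
  have hmeas : Measurable (WithLp.toLp 2 : (Fin n → ℂ) → EuclideanSpace ℂ (Fin n)) :=
    WithLp.measurable_toLp 2 _
  have hνp : IsProbabilityMeasure ν := Measure.isProbabilityMeasure_map hmeas.aemeasurable
  set μ' : Measure (EuclideanSpace ℂ (Fin n)) :=
    (volume : Measure (Fin n → ℂ)).map (WithLp.toLp 2) with hμ'
  have hH : μ'.IsAddHaarMeasure :=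
    L.symm.isAddHaarMeasure_map (volume : Measure (Fin n → ℂ))
  -- The Gaussian measure has a radial density with respect to some Haar measure.
  have hdens : ν = μ'.withDensity fun x => f ‖x‖ := by
    have : ∀ _ : Fin n, SigmaFinite ((volume : Measure ℂ).withDensity fun z : ℂ =>
      ENNReal.ofReal ((2 * Real.pi)⁻¹ * Real.exp (-‖z‖ ^ 2 / 2))) := by
      intro _
      rw [← complexGaussian_one_eq_withDensity]
      infer_instance
    rw [hν, hμ']
    simp_rw [complexGaussian_one_eq_withDensity]
    rw [pi_withDensity fun i => by fun_prop]
    ext s hs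
    rw [Measure.map_apply hmeas hs, withDensity_apply _ (hmeas hs), withDensity_apply _ hs,
      setLIntegral_map hs (by fun_prop) hmeas]
    refine lintegral_congr fun z => ?_
    rw [← ENNReal.ofReal_prod_of_nonneg fun i _ => by positivity, Finset.prod_mul_distrib,
      ← Real.exp_sum, Finset.prod_const, Finset.card_univ, Fintype.card_fin]
    simp only [f, EuclideanSpace.norm_sq_eq, ← Finset.sum_div, Finset.sum_neg_distrib]
  have hvol : μ' = (Measure.addHaarScalarFactor μ' volume) •
      (volume : Measure (EuclideanSpace ℂ (Fin n))) := Measure.isAddLeftInvariant_eq_smul _ _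
  set c := Measure.addHaarScalarFactor μ' (volume : Measure (EuclideanSpace ℂ (Fin n)))
  have hdens' : ν = (volume : Measure (EuclideanSpace ℂ (Fin n))).withDensity
      fun x => (fun r => c * f r) ‖x‖ := by
    rw [hdens, hvol]
    have h1 := withDensity_smul_measure (c : ℝ≥0∞)
      (μ := (volume : Measure (EuclideanSpace ℂ (Fin n)))) (fun x => f ‖x‖)
    have h2 := withDensity_smul (μ := (volume : Measure (EuclideanSpace ℂ (Fin n))))
      (c : ℝ≥0∞) (f := fun x => f ‖x‖) (by fun_prop)
    exact h1.trans h2.symm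
  have : IsProbabilityMeasure ((volume : Measure (EuclideanSpace ℂ (Fin n))).withDensity
      fun x => (fun r => c * f r) ‖x‖) := by
    rw [← hdens']
    exact hνp
  have key := map_direction_withDensity (volume : Measure (EuclideanSpace ℂ (Fin n)))
    (f := fun r => c * f r) (by fun_prop) e
  rw [← hdens', hν, Measure.map_map (measurable_direction e) hmeas] at key
  exact key

/-! ### Estimating the equivariant box distance by a random pair of points -/

section Displacement

variable {X Y : Type*} [PseudoMetricSpace X] [PseudoMetricSpace Y]

theorem continuous_displacement_inl {g : X → X} (hg : Continuous g) :
    Continuous fun z : (X × Y) × (X × Y) =>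
      displacement (Sum.inl g : (X → X) ⊕ (Y → Y)) z.1 z.2 := by
  simp only [displacement]
  fun_prop

theorem continuous_displacement_inr {h : Y → Y} (hh : Continuous h) :
    Continuous fun z : (X × Y) × (X × Y) =>
      displacement (Sum.inr h : (X → X) ⊕ (Y → Y)) z.1 z.2 := by
  simp only [displacement]
  fun_prop

end Displacement

theorem map_prodMk_mem_couplings {X Y Ω : Type*} [MeasurableSpace X] [MeasurableSpace Y]
    [MeasurableSpace Ω] {P : Measure Ω} {u : Ω → X} {v : Ω → Y}
    (hu : AEMeasurable u P) (hv : AEMeasurable v P) :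
    (P.map fun ω => (u ω, v ω)) ∈ couplings (P.map u) (P.map v) := by
  constructor
  · rw [AEMeasurable.map_map_of_aemeasurable measurable_fst.aemeasurable (hu.prodMk hv)]
    rfl
  · rw [AEMeasurable.map_map_of_aemeasurable measurable_snd.aemeasurable (hu.prodMk hv)]
    rfl

section Plan

variable {X Y Ω : Type*} [PseudoMetricSpace X] [MeasurableSpace X]
  [PseudoMetricSpace Y] [MeasurableSpace Y]

/-- An estimate of `d^π` for the joint law `π` of a random pair of points `(u, v)`: it is enough to
compare the displacements on an event `T` of large probability. The closed subset of the support
that enters `d^π` is cut out of the closure of `(u, v) '' T`. -/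
theorem distPlan_map_le [OpensMeasurableSpace X] [OpensMeasurableSpace Y]
    [SecondCountableTopology X] [SecondCountableTopology Y] [MeasurableSpace Ω] {P : Measure Ω}
    [IsProbabilityMeasure P] {u : Ω → X} {v : Ω → Y} (hu : AEMeasurable u P)
    (hv : AEMeasurable v P) {γ₁ γ₂ : (X → X) ⊕ (Y → Y)}
    (h₁ : Continuous fun z : (X × Y) × (X × Y) => displacement γ₁ z.1 z.2)
    (h₂ : Continuous fun z : (X × Y) × (X × Y) => displacement γ₂ z.1 z.2)
    {T : Set Ω} {ε : ℝ} (hT : P Tᶜ ≤ ENNReal.ofReal ε)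
    (h : ∀ ω ∈ T, ∀ ω' ∈ T, |displacement γ₁ (u ω, v ω) (u ω', v ω') -
      displacement γ₂ (u ω, v ω) (u ω', v ω')| ≤ ε) :
    distPlan (P.map fun ω => (u ω, v ω)) γ₁ γ₂ ≤ ENNReal.ofReal ε := by
  set π := P.map fun ω => (u ω, v ω) with hπ
  set A : Set (X × Y) := (fun ω => (u ω, v ω)) '' T with hA
  refine iInf_le_of_le (closure A ∩ π.support) <|
    iInf_le_of_le (isClosed_closure.inter Measure.isClosed_support) <|
    iInf_le_of_le Set.inter_subset_right <| max_le ?_ ?_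
  · rw [measure_inter_conull Measure.measure_compl_support, tsub_le_iff_left]
    calc (1 : ℝ≥0∞) = P Set.univ := measure_univ.symm
      _ ≤ P T + P Tᶜ := by
        rw [← Set.union_compl_self T]
        exact measure_union_le _ _
      _ ≤ π (closure A) + ENNReal.ofReal ε := by
        refine add_le_add ?_ hT
        refine le_trans (measure_mono fun ω hω => ?_) (Measure.le_map_apply (hu.prodMk hv) _)
        exact subset_closure ⟨ω, hω, rfl⟩
  · have hclosed : IsClosed {z : (X × Y) × (X × Y) |
        |displacement γ₁ z.1 z.2 - displacement γ₂ z.1 z.2| ≤ ε} :=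
      isClosed_le (h₁.sub h₂).abs continuous_const
    have hsub : closure A ×ˢ closure A ⊆ {z : (X × Y) × (X × Y) |
        |displacement γ₁ z.1 z.2 - displacement γ₂ z.1 z.2| ≤ ε} := by
      rw [← closure_prod_eq]
      refine closure_minimal ?_ hclosed
      rintro ⟨_, _⟩ ⟨⟨ω, hω, rfl⟩, ⟨ω', hω', rfl⟩⟩
      exact h ω hω ω' hω'
    refine iSup₂_le fun p hp => iSup₂_le fun q hq => ENNReal.ofReal_le_ofReal ?_
    exact hsub (Set.mk_mem_prod hp.1 hq.1)

theorem eqBoxDist_le {μ : Measure X} {ν : Measure Y} {G : Set (X → X)} {H : Set (Y → Y)}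
    {π : Measure (X × Y)} (hπ : π ∈ couplings μ ν) {ε : ℝ≥0∞}
    (hG : ∀ g ∈ G, ∃ h ∈ H, distPlan π (Sum.inl g) (Sum.inr h) ≤ ε)
    (hH : ∀ h ∈ H, ∃ g ∈ G, distPlan π (Sum.inl g) (Sum.inr h) ≤ ε) :
    eqBoxDist μ G ν H ≤ ε := by
  have hsymm : ∀ γ₁ γ₂ : (X → X) ⊕ (Y → Y), distPlan π γ₁ γ₂ = distPlan π γ₂ γ₁ := by
    intro γ₁ γ₂
    simp only [distPlan, distOn, abs_sub_comm]
  refine iInf₂_le_of_le π hπ (max_le ?_ ?_)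
  · refine iSup₂_le ?_
    rintro _ ⟨g, hg, rfl⟩
    obtain ⟨h, hh, hle⟩ := hG g hg
    exact iInf₂_le_of_le _ ⟨h, hh, rfl⟩ hle
  · refine iSup₂_le ?_
    rintro _ ⟨h, hh, rfl⟩
    obtain ⟨g, hg, hle⟩ := hH h hh
    exact iInf₂_le_of_le _ ⟨g, hg, rfl⟩ hle

end Plan

/-! ### The metric of orbit spaces -/

section OrbitSpace

variable {G X : Type*} [Group G] [MulAction G X] [PseudoMetricSpace X] [IsIsometricSMul G X]

theorem OrbitSpace.dist_mk_le (g : G) (x y : X) :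
    dist (OrbitSpace.mk G x) (OrbitSpace.mk G y) ≤ dist (g • x) y :=
  csInf_le (OrbitSpace.distSet_bddBelow _ _)
    ⟨g • x, y, OrbitSpace.mk_eq_mk_iff.2 ⟨g, rfl⟩, rfl, rfl⟩

theorem OrbitSpace.le_dist_mk {r : ℝ} {x y : X} (h : ∀ g : G, r ≤ dist (g • x) y) :
    r ≤ dist (OrbitSpace.mk G x) (OrbitSpace.mk G y) := by
  refine le_csInf (OrbitSpace.distSet_nonempty _ _) ?_
  rintro _ ⟨x', y', hx, hy, rfl⟩
  obtain ⟨g, rfl⟩ := OrbitSpace.mk_eq_mk_iff.1 hx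
  obtain ⟨g', rfl⟩ := OrbitSpace.mk_eq_mk_iff.1 hy
  have := h (g'⁻¹ * g)
  rwa [mul_smul, ← dist_smul g', smul_inv_smul] at this

theorem OrbitSpace.lipschitzWith_mk : LipschitzWith 1 (OrbitSpace.mk G : X → OrbitSpace G X) :=
  LipschitzWith.of_dist_le_mul fun x y => by
    simpa using OrbitSpace.dist_mk_le (1 : G) x y

theorem OrbitSpace.measurable_mk [MeasurableSpace X] [OpensMeasurableSpace X] :
    Measurable (OrbitSpace.mk G : X → OrbitSpace G X) :=
  OrbitSpace.lipschitzWith_mk.continuous.measurable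

instance OrbitSpace.instSecondCountableTopology [SecondCountableTopology X] :
    SecondCountableTopology (OrbitSpace G X) := by
  have := (OrbitSpace.mk_surjective (G := G) (X := X)).denseRange.separableSpace
    OrbitSpace.lipschitzWith_mk.continuous
  exact UniformSpace.secondCountable_of_separable _

end OrbitSpace

/-! ### Comparing almost equivariantly close points -/

section Compare

variable {X V : Type*} [PseudoMetricSpace X] [MulAction Circle X]
  [NormedAddCommGroup V] [NormedSpace ℂ V] {ι : X → V} {ε δ R : ℝ}

/-- Moving `(x₁, y₁)` by nearby rotations `c` and `c'` gives nearby distances to `(x₂, y₂)`, when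
`x₁`, `x₂` are close to `y₁`, `y₂` in `V`. -/
theorem abs_dist_smul_sub_dist_smul_le (hι : Isometry ι)
    (hsmul : ∀ (c : Circle) (x : X), ι (c • x) = c • ι x) {c c' : Circle}
    (hc : ‖(c : ℂ) - c'‖ ≤ δ) {x₁ x₂ : X} {y₁ y₂ : V}
    (h₁ : dist (ι x₁) y₁ ≤ ε) (h₂ : dist (ι x₂) y₂ ≤ ε) (hR : ‖y₁‖ ≤ R) :
    |dist (c • x₁) x₂ - dist (c' • y₁) y₂| ≤ 2 * ε + δ * R := by
  have hV : IsIsometricSMul Circle V := circle_isIsometricSMul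
  rw [← hι.dist_eq, hsmul, ← Real.dist_eq]
  calc dist (dist (c • ι x₁) (ι x₂)) (dist (c' • y₁) y₂)
      ≤ dist (c • ι x₁) (c' • y₁) + dist (ι x₂) y₂ := dist_dist_dist_le _ _ _ _
    _ ≤ (dist (c • ι x₁) (c • y₁) + dist (c • y₁) (c' • y₁)) + dist (ι x₂) y₂ := by
      gcongr
      exact dist_triangle _ _ _
    _ ≤ (ε + δ * R) + ε := by
      rw [dist_smul]
      gcongr
      rw [dist_eq_norm, Circle.smul_def, Circle.smul_def, ← sub_smul, norm_smul]
      exact mul_le_mul hc hR (norm_nonneg _) ((norm_nonneg _).trans hc)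
    _ = 2 * ε + δ * R := by ring

theorem abs_dist_orbit_sub_dist_orbit_le [IsIsometricSMul Circle X] [IsIsometricSMul Circle V]
    (hι : Isometry ι)
    (hsmul : ∀ (c : Circle) (x : X), ι (c • x) = c • ι x) {K : Subgroup Circle}
    (hK : ∀ c : Circle, ∃ k ∈ K, ‖(k : ℂ) - c‖ ≤ δ) {x₁ x₂ : X} {y₁ y₂ : V}
    (h₁ : dist (ι x₁) y₁ ≤ ε) (h₂ : dist (ι x₂) y₂ ≤ ε) (hR : ‖y₁‖ ≤ R) :
    |dist (OrbitSpace.mk K x₁) (OrbitSpace.mk K x₂) -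
      dist (OrbitSpace.mk Circle y₁) (OrbitSpace.mk Circle y₂)| ≤ 2 * ε + δ * R := by
  have hδ : 0 ≤ δ := by
    obtain ⟨k, -, hk⟩ := hK 1
    exact (norm_nonneg _).trans hk
  rw [abs_sub_le_iff]
  constructor
  · rw [sub_le_comm]
    refine OrbitSpace.le_dist_mk fun c => ?_
    obtain ⟨k, hkK, hk⟩ := hK c
    have h3 := (abs_sub_le_iff.1 (abs_dist_smul_sub_dist_smul_le hι hsmul hk h₁ h₂ hR)).1
    have h4 : dist (OrbitSpace.mk K x₁) (OrbitSpace.mk K x₂) ≤ dist (k • x₁) x₂ :=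
      OrbitSpace.dist_mk_le (⟨k, hkK⟩ : K) x₁ x₂
    linarith
  · rw [sub_le_comm]
    refine OrbitSpace.le_dist_mk fun k => ?_
    have h3 := (abs_sub_le_iff.1 (abs_dist_smul_sub_dist_smul_le hι hsmul (c := k) (c' := k)
      (δ := δ) (by simpa using hδ) h₁ h₂ hR)).2
    have h4 := OrbitSpace.dist_mk_le (k : Circle) y₁ y₂
    have h5 : dist (k • x₁) x₂ = dist ((k : Circle) • x₁) x₂ := rfl
    linarith

end Compare

/-! ### Random pairs in a space with a circle action and in a normed space -/

section RandomPair

variable {X V Ω : Type*} [PseudoMetricSpace X] [MulAction Circle X] [IsIsometricSMul Circle X]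
  [SecondCountableTopology X] [MeasurableSpace X] [OpensMeasurableSpace X]
  [NormedAddCommGroup V] [NormedSpace ℂ V] [IsIsometricSMul Circle V]
  [SecondCountableTopology V] [MeasurableSpace V] [OpensMeasurableSpace V]
  [MeasurableSpace Ω] {P : Measure Ω} [IsProbabilityMeasure P] {u : Ω → X} {v : Ω → V} {ι : X → V}
  {ε δ R : ℝ}

/-- If random points `u` of `X` and `v` of `V` are close on a large event, and `K` is `δ`-dense in
the circle, then the spaces are close in the equivariant box distance. The term `δ * R` is the
displacement of a vector of norm at most `R` by a rotation of angle about `δ`. -/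
theorem eqBoxDist_map_le (hu : AEMeasurable u P) (hv : AEMeasurable v P) (hι : Isometry ι)
    (hsmul : ∀ (c : Circle) (x : X), ι (c • x) = c • ι x) {K : Subgroup Circle}
    (hK : ∀ c : Circle, ∃ k ∈ K, ‖(k : ℂ) - c‖ ≤ δ)
    (hP : P {ω | dist (ι (u ω)) (v ω) ≤ ε ∧ ‖v ω‖ ≤ R}ᶜ ≤ ENNReal.ofReal (2 * ε + δ * R)) :
    eqBoxDist (P.map u) (actionMaps K X) (P.map v) (actionMaps Circle V) ≤
      ENNReal.ofReal (2 * ε + δ * R) := by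
  have hδ : 0 ≤ δ := by
    obtain ⟨k, -, hk⟩ := hK 1
    exact (norm_nonneg _).trans hk
  have key : ∀ (k : K) (c : Circle), ‖((k : Circle) : ℂ) - c‖ ≤ δ →
      distPlan (P.map fun ω => (u ω, v ω)) (Sum.inl fun x => k • x) (Sum.inr fun y => c • y) ≤
        ENNReal.ofReal (2 * ε + δ * R) := by
    intro k c hkc
    refine distPlan_map_le hu hv
      (continuous_displacement_inl (isometry_smul X k).continuous)
      (continuous_displacement_inr (isometry_smul V c).continuous) hP fun ω hω ω' hω' => ?_
    exact abs_dist_smul_sub_dist_smul_le hι hsmul hkc hω.1 hω'.1 hω.2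
  refine eqBoxDist_le (map_prodMk_mem_couplings hu hv) ?_ ?_
  · rintro _ ⟨k, rfl⟩
    exact ⟨_, ⟨(k : Circle), rfl⟩, key k k (by simpa using hδ)⟩
  · rintro _ ⟨c, rfl⟩
    obtain ⟨k, hkK, hk⟩ := hK c
    exact ⟨_, ⟨⟨k, hkK⟩, rfl⟩, key ⟨k, hkK⟩ c hk⟩

/-- The analogue of `eqBoxDist_map_le` for the quotients, with the coupling of the orbit measures
induced by `(u, v)`. -/
theorem boxDist_orbitMeasure_map_le (hu : AEMeasurable u P) (hv : AEMeasurable v P)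
    (hι : Isometry ι) (hsmul : ∀ (c : Circle) (x : X), ι (c • x) = c • ι x) {K : Subgroup Circle}
    (hK : ∀ c : Circle, ∃ k ∈ K, ‖(k : ℂ) - c‖ ≤ δ)
    (hP : P {ω | dist (ι (u ω)) (v ω) ≤ ε ∧ ‖v ω‖ ≤ R}ᶜ ≤ ENNReal.ofReal (2 * ε + δ * R)) :
    boxDist (orbitMeasure K (P.map u)) (orbitMeasure Circle (P.map v)) ≤
      ENNReal.ofReal (2 * ε + δ * R) := by
  have hmX : Measurable (OrbitSpace.mk K : X → _) := OrbitSpace.measurable_mk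
  have hmV : Measurable (OrbitSpace.mk Circle : V → _) := OrbitSpace.measurable_mk
  rw [orbitMeasure, orbitMeasure, AEMeasurable.map_map_of_aemeasurable hmX.aemeasurable hu,
    AEMeasurable.map_map_of_aemeasurable hmV.aemeasurable hv]
  have hu' := hmX.comp_aemeasurable hu
  have hv' := hmV.comp_aemeasurable hv
  have key := distPlan_map_le hu' hv' (continuous_displacement_inl continuous_id)
    (continuous_displacement_inr continuous_id) hP fun ω hω ω' hω' =>
      abs_dist_orbit_sub_dist_orbit_le hι hsmul hK hω.1 hω'.1 hω.2
  refine eqBoxDist_le (map_prodMk_mem_couplings hu' hv') ?_ ?_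
  · rintro _ rfl
    exact ⟨id, rfl, key⟩
  · rintro _ rfl
    exact ⟨id, rfl, key⟩

end RandomPair

/-! ### The quotient of a Hilbert space by the circle is a cone -/

section Cone

variable {V : Type*} [NormedAddCommGroup V] [InnerProductSpace ℂ V]

theorem exists_circle_coe_eq {b : ℂ} (hb : ‖b‖ = 1) : ∃ c : Circle, (c : ℂ) = b :=
  ⟨⟨b, by simpa [Submonoid.unitSphere] using hb⟩, rfl⟩

theorem exists_circle_inner_smul_eq_norm (z w : V) :
    ∃ c : Circle, inner ℂ (c • z) w = (‖inner ℂ z w‖ : ℂ) := by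
  rcases eq_or_ne (inner ℂ z w) 0 with h | h
  · exact ⟨1, by simp [h]⟩
  · have hn : (‖inner ℂ z w‖ : ℂ) ≠ 0 := by simpa using h
    obtain ⟨c, hc⟩ : ∃ c : Circle, (c : ℂ) = inner ℂ z w / ‖inner ℂ z w‖ :=
      exists_circle_coe_eq (by simp [h])
    refine ⟨c, ?_⟩
    rw [Circle.smul_def, inner_smul_left, hc]
    simp only [map_div₀, Complex.conj_ofReal]
    rw [div_mul_eq_mul_div, div_eq_iff hn, mul_comm, Complex.mul_conj, Complex.normSq_eq_norm_sq]
    push_cast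
    ring

theorem dist_orbitSpace_mk [IsIsometricSMul Circle V] (z w : V) :
    dist (OrbitSpace.mk Circle z) (OrbitSpace.mk Circle w) =
      √(‖z‖ ^ 2 + ‖w‖ ^ 2 - 2 * ‖(inner ℂ z w : ℂ)‖) := by
  have hexp : ∀ c : Circle, dist (c • z) w ^ 2 =
      ‖z‖ ^ 2 + ‖w‖ ^ 2 - 2 * (inner ℂ (c • z) w : ℂ).re := by
    intro c
    have hc : ‖c • z‖ = ‖z‖ := by rw [Circle.smul_def, norm_smul, Circle.norm_coe, one_mul]
    rw [dist_eq_norm, @norm_sub_sq ℂ, hc]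
    simp only [RCLike.re_to_complex]
    ring
  apply le_antisymm
  · obtain ⟨c, hc⟩ := exists_circle_inner_smul_eq_norm z w
    refine (OrbitSpace.dist_mk_le c z w).trans (Real.le_sqrt_of_sq_le ?_)
    rw [hexp, hc, Complex.ofReal_re]
  · refine OrbitSpace.le_dist_mk fun c => Real.sqrt_le_iff.2 ⟨dist_nonneg, ?_⟩
    rw [hexp]
    have : (inner ℂ (c • z) w : ℂ).re ≤ ‖(inner ℂ z w : ℂ)‖ := by
      refine (Complex.re_le_norm _).trans_eq ?_
      rw [Circle.smul_def, inner_smul_left, norm_mul, RCLike.norm_conj, Circle.norm_coe, one_mul]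
    linarith

/-- The unit vector in the direction of the chosen representative of a point of the projective
space. -/
noncomputable def unitRep (p : Projectivization ℂ V) : V := ((‖p.rep‖⁻¹ : ℝ) : ℂ) • p.rep

theorem norm_unitRep (p : Projectivization ℂ V) : ‖unitRep p‖ = 1 := by
  rw [unitRep, norm_smul, Complex.norm_real, norm_inv, norm_norm,
    inv_mul_cancel₀ (norm_ne_zero_iff.2 p.rep_nonzero)]

theorem cos_fubiniStudyDist (p q : Projectivization ℂ V) :
    Real.cos (min (fubiniStudyDist p q) Real.pi) = ‖(inner ℂ (unitRep p) (unitRep q) : ℂ)‖ := by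
  have hp := norm_pos_iff.2 p.rep_nonzero
  have hq := norm_pos_iff.2 q.rep_nonzero
  rw [fubiniStudyDist, min_eq_left (Real.arccos_le_pi _), Real.cos_arccos]
  · rw [unitRep, unitRep, inner_smul_left, inner_smul_right, norm_mul, norm_mul, RCLike.norm_conj,
      Complex.norm_real, Complex.norm_real, norm_inv, norm_inv, norm_norm, norm_norm]
    field_simp
  · exact (by norm_num : (-1 : ℝ) ≤ 0).trans (by positivity)
  · exact (div_le_one (by positivity)).2 (norm_inner_le_norm _ _)

theorem circle_smul_unitRep_eq_iff (p q : Projectivization ℂ V) :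
    (∃ c : Circle, c • unitRep q = unitRep p) ↔ p = q := by
  constructor
  · rintro ⟨c, hc⟩
    rw [← p.mk_rep, ← q.mk_rep, Projectivization.mk_eq_mk_iff']
    refine ⟨‖p.rep‖ * (c * (‖q.rep‖⁻¹ : ℝ)), ?_⟩
    rw [Circle.smul_def, unitRep, unitRep, smul_smul] at hc
    rw [mul_smul, hc, smul_smul, Complex.ofReal_inv, mul_inv_cancel₀, one_smul]
    simpa using p.rep_nonzero
  · rintro rfl
    exact ⟨1, one_smul _ _⟩

/-- A point `r • u` of the cone over the projective space, with `u` a unit vector, corresponds to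
the orbit of the vector `r • u`. -/
noncomputable def coneMap (x : ℝ≥0 × Projectivization ℂ V) : OrbitSpace Circle V :=
  OrbitSpace.mk Circle (((x.1 : ℝ) : ℂ) • unitRep x.2)

theorem isEuclideanCone_coneMap [Nontrivial V] [IsIsometricSMul Circle V] :
    IsEuclideanCone fubiniStudyDist (coneMap (V := V)) where
  surjective := by
    intro o
    obtain ⟨z, rfl⟩ := OrbitSpace.mk_surjective o
    rcases eq_or_ne z 0 with rfl | hz
    · obtain ⟨w, hw⟩ := exists_ne (0 : V)
      exact ⟨(0, Projectivization.mk ℂ w hw), by simp [coneMap]⟩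
    · set p := Projectivization.mk ℂ z hz with hp
      obtain ⟨a, ha⟩ := Projectivization.exists_smul_eq_mk_rep ℂ z hz
      have hu : ∃ b : ℂ, ‖b‖ = 1 ∧ b • z = (‖z‖ : ℂ) • unitRep p := by
        have hzn : ‖z‖ ≠ 0 := norm_ne_zero_iff.2 hz
        refine ⟨‖z‖ * ((‖p.rep‖⁻¹ : ℝ) * (a : ℂ)), ?_, ?_⟩
        · have han : ‖(a : ℂ)‖ ≠ 0 := norm_ne_zero_iff.2 a.ne_zero
          have : ‖p.rep‖ = ‖(a : ℂ)‖ * ‖z‖ := by rw [hp, ← ha, Units.smul_def, norm_smul]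
          rw [norm_mul, norm_mul, Complex.norm_real, Complex.norm_real, norm_norm, norm_inv,
            norm_norm, this]
          field_simp
        · rw [mul_smul, mul_smul, ← Units.smul_def, ha, unitRep]
      obtain ⟨b, hb, hbz⟩ := hu
      obtain ⟨c, rfl⟩ := exists_circle_coe_eq hb
      exact ⟨(⟨‖z‖, norm_nonneg z⟩, p), OrbitSpace.mk_eq_mk_iff.2 ⟨c, hbz⟩⟩
  eq_iff := by
    rintro ⟨r, p⟩ ⟨s, q⟩
    simp only [coneMap]
    rw [OrbitSpace.mk_eq_mk_iff]
    constructor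
    · rintro ⟨c, hc⟩
      have hrs : r = s := by
        have := congrArg norm hc
        rw [Circle.smul_def, norm_smul, norm_smul, norm_smul, Circle.norm_coe, norm_unitRep,
          norm_unitRep, Complex.norm_real, Complex.norm_real, one_mul, mul_one, mul_one,
          NNReal.norm_eq, NNReal.norm_eq] at this
        exact NNReal.eq this.symm
      subst hrs
      refine ⟨rfl, or_iff_not_imp_left.2 fun hr => (circle_smul_unitRep_eq_iff p q).1 ⟨c, ?_⟩⟩
      have hr' : ((r : ℝ) : ℂ) ≠ 0 := by simpa using hr
      rw [Circle.smul_def, smul_comm] at hc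
      exact smul_right_injective V hr' hc
    · rintro ⟨rfl, rfl | h⟩
      · exact ⟨1, by simp⟩
      · obtain rfl : p = q := h
        exact ⟨1, one_smul _ _⟩
  dist_eq := by
    rintro ⟨r, p⟩ ⟨s, q⟩
    simp only [coneMap]
    rw [dist_orbitSpace_mk, cos_fubiniStudyDist, norm_smul, norm_smul, norm_unitRep, norm_unitRep,
      inner_smul_left, inner_smul_right, norm_mul, norm_mul, RCLike.norm_conj, Complex.norm_real,
      Complex.norm_real, NNReal.norm_eq, NNReal.norm_eq]
    congr 1
    ring

end Cone

/-! ### Density of cyclic groups in the circle -/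

theorem exists_mem_cyclicSubgroup_norm_sub_le (j : ℕ) [NeZero j] (c : Circle) :
    ∃ k ∈ cyclicSubgroup j, ‖(k : ℂ) - c‖ ≤ 2 * Real.pi / j := by
  have hj : (0 : ℝ) < j := Nat.cast_pos.2 (Nat.pos_of_ne_zero (NeZero.ne j))
  set θ := (c : ℂ).arg with hθ
  set m : ℤ := ⌊θ * j / (2 * Real.pi)⌋ with hm
  refine ⟨ZMod.toCircle (m : ZMod j), ⟨(m : ZMod j), rfl⟩, ?_⟩
  have hc : (c : ℂ) = Complex.exp (Complex.I * θ) := by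
    rw [mul_comm, ← Circle.coe_exp, hθ, Circle.exp_arg]
  have hk : (ZMod.toCircle (m : ZMod j) : ℂ) =
      Complex.exp (Complex.I * ((2 * Real.pi * m / j : ℝ) : ℂ)) := by
    rw [ZMod.toCircle_intCast]
    congr 1
    push_cast
    ring
  rw [hc, hk]
  have hsub : Complex.exp (Complex.I * ((2 * Real.pi * m / j : ℝ) : ℂ)) -
      Complex.exp (Complex.I * θ) = Complex.exp (Complex.I * θ) *
        (Complex.exp (Complex.I * ((2 * Real.pi * m / j - θ : ℝ) : ℂ)) - 1) := by
    rw [mul_sub, ← Complex.exp_add, mul_one]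
    congr 2
    push_cast
    ring
  rw [hsub, norm_mul, mul_comm Complex.I (θ : ℂ), Complex.norm_exp_ofReal_mul_I, one_mul]
  refine (Real.norm_exp_I_mul_ofReal_sub_one_le).trans ?_
  have h1 : (m : ℝ) ≤ θ * j / (2 * Real.pi) := Int.floor_le _
  have h2 : θ * j / (2 * Real.pi) < m + 1 := Int.lt_floor_add_one _
  have hπ := Real.pi_pos
  rw [le_div_iff₀ (by positivity)] at h1
  rw [div_lt_iff₀ (by positivity)] at h2
  rw [Real.norm_eq_abs, abs_le]
  constructor
  · rw [le_sub_iff_add_le, neg_add_eq_sub, sub_le_iff_le_add, ← add_div, le_div_iff₀ hj]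
    nlinarith
  · rw [sub_le_iff_le_add, ← sub_le_iff_le_add', ← sub_div, div_le_iff₀ hj]
    nlinarith

/-! ### Square-summable sequences -/

section Seq

theorem memℓp_two_iff {x : ℕ → ℂ} : Memℓp x 2 ↔ Summable fun i => ‖x i‖ ^ 2 := by
  rw [memℓp_gen_iff (by norm_num)]
  simp

theorem norm_sq_eq_tsum (y : HilbertSeq) : ‖y‖ ^ 2 = ∑' i, ‖y i‖ ^ 2 := by
  simpa using lp.norm_rpow_eq_tsum (p := 2) (by norm_num) y

instance : Nontrivial HilbertSeq :=
  nontrivial_of_ne (lp.single 2 0 (1 : ℂ)) 0 <| norm_ne_zero_iff.1 <| by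
    rw [lp.norm_single (by norm_num)]
    simp

instance : SecondCountableTopology HilbertSeq := by
  suffices h : TopologicalSpace.SeparableSpace HilbertSeq from
    UniformSpace.secondCountable_of_separable _
  rw [← TopologicalSpace.isSeparable_univ_iff]
  have hs : TopologicalSpace.IsSeparable
      (Set.range fun p : ℕ × ℂ => (lp.single 2 p.1 p.2 : HilbertSeq)) := by
    have : (Set.range fun p : ℕ × ℂ => (lp.single 2 p.1 p.2 : HilbertSeq)) =
        ⋃ i : ℕ, Set.range fun z : ℂ => (lp.single 2 i z : HilbertSeq) := by
      ext y
      simp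
    rw [this]
    exact TopologicalSpace.IsSeparable.iUnion fun i =>
      TopologicalSpace.isSeparable_range (lp.isometry_single (E := fun _ : ℕ => ℂ) (p := 2) i).continuous
  refine (hs.span (R := ℂ)).closure.mono fun y _ => ?_
  refine mem_closure_of_tendsto (lp.hasSum_single (by norm_num) y) (Eventually.of_forall fun s => ?_)
  exact Submodule.sum_mem _ fun i _ => Submodule.subset_span ⟨(i, y i), rfl⟩

/-- By the Lusin–Souslin theorem, `ℓ²` is a Borel subset of `ℂ^ℕ`, with the induced Borel
structure. -/
theorem measurableEmbedding_coe : MeasurableEmbedding fun (y : HilbertSeq) (i : ℕ) => y i := by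
  have hc : Continuous fun (y : HilbertSeq) (i : ℕ) => y i :=
    lp.uniformContinuous_coe.continuous
  exact hc.measurableEmbedding Subtype.coe_injective

open scoped Classical in
/-- The element of `ℓ²` with the coordinates `x`, with the value `0` if `x` is not
square-summable. -/
noncomputable def toSeq (x : ℕ → ℂ) : HilbertSeq :=
  if h : Memℓp x 2 then ⟨x, h⟩ else 0

theorem coe_toSeq {x : ℕ → ℂ} (hx : Memℓp x 2) : (fun i => toSeq x i) = x := by
  rw [toSeq, dif_pos hx]

theorem measurable_toSeq : Measurable toSeq := by
  classical
  have hr : Set.range (fun (y : HilbertSeq) (i : ℕ) => y i) = {x | Memℓp x 2} := by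
    ext x
    exact ⟨fun ⟨y, hy⟩ => hy ▸ y.2, fun hx => ⟨⟨x, hx⟩, rfl⟩⟩
  have hm : MeasurableSet {x : ℕ → ℂ | Memℓp x 2} := hr ▸ measurableEmbedding_coe.measurableSet_range
  rw [← measurableEmbedding_coe.measurable_comp_iff]
  have : (fun (y : HilbertSeq) (i : ℕ) => y i) ∘ toSeq =
      fun x => if x ∈ {x : ℕ → ℂ | Memℓp x 2} then x else 0 := by
    funext x
    by_cases hx : Memℓp x 2
    · simp [toSeq, hx]
    · simp [toSeq, hx]
      rfl
  rw [this]
  exact Measurable.ite hm measurable_id measurable_const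

variable {n : ℕ}

/-- The inclusion `ℂⁿ → ℓ²`, extending a vector by zero. -/
noncomputable def extendSeq (z : EuclideanSpace ℂ (Fin n)) : HilbertSeq :=
  ⟨fun i => if h : i < n then z ⟨i, h⟩ else 0, memℓp_two_iff.2 <|
    summable_of_ne_finset_zero (s := Finset.range n) fun i hi => by
      simp [Finset.mem_range.not.1 hi]⟩

theorem extendSeq_apply (z : EuclideanSpace ℂ (Fin n)) (i : ℕ) :
    extendSeq z i = if h : i < n then z ⟨i, h⟩ else 0 := rfl

theorem norm_extendSeq (z : EuclideanSpace ℂ (Fin n)) : ‖extendSeq z‖ = ‖z‖ := by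
  rw [← sq_eq_sq₀ (norm_nonneg _) (norm_nonneg _), norm_sq_eq_tsum, EuclideanSpace.norm_sq_eq,
    tsum_eq_sum (s := Finset.range n) fun i hi => by
      simp [extendSeq_apply, Finset.mem_range.not.1 hi], Finset.sum_range]
  simp [extendSeq_apply]

theorem isometry_extendSeq : Isometry (extendSeq : EuclideanSpace ℂ (Fin n) → HilbertSeq) := by
  refine Isometry.of_dist_eq fun z w => ?_
  rw [dist_eq_norm, dist_eq_norm, ← norm_extendSeq]
  congr 1
  ext i
  by_cases h : i < n <;> simp [extendSeq_apply, h]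

theorem extendSeq_smul (c : ℂ) (z : EuclideanSpace ℂ (Fin n)) :
    extendSeq (c • z) = c • extendSeq z := by
  ext i
  by_cases h : i < n <;> simp [extendSeq_apply, h]

end Seq

/-! ### The Gaussian measure on `ℓ²` as the law of a random sequence -/

/-- The law of a sequence of independent standard complex Gaussian variables. -/
noncomputable abbrev stdGaussianSeq : Measure (ℕ → ℂ) :=
  Measure.infinitePi fun _ => complexGaussian 1

/-- The random element `(aᵢ ωᵢ)ᵢ` of `ℓ²`. -/
noncomputable def scaledSeq (a : ℕ → ℝ) (ω : ℕ → ℂ) : HilbertSeq :=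
  toSeq fun i => (a i : ℂ) * ω i

theorem measurable_scaledSeq (a : ℕ → ℝ) : Measurable (scaledSeq a) :=
  measurable_toSeq.comp (by fun_prop)

theorem lintegral_tsum_sq_mul_norm_sq {a : ℕ → ℝ} (ha : Summable fun i => a i ^ 2) :
    ∫⁻ ω, ∑' i, ENNReal.ofReal (‖(a i : ℂ) * ω i‖ ^ 2) ∂stdGaussianSeq =
      ENNReal.ofReal (2 * ∑' i, a i ^ 2) := by
  have h1 : ∀ i, ∫⁻ ω, ENNReal.ofReal (‖(a i : ℂ) * ω i‖ ^ 2) ∂stdGaussianSeq =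
      ENNReal.ofReal (a i ^ 2) * 2 := by
    intro i
    have h2 : ∀ ω : ℕ → ℂ, ENNReal.ofReal (‖(a i : ℂ) * ω i‖ ^ 2) =
        ENNReal.ofReal (a i ^ 2) * ENNReal.ofReal (‖ω i‖ ^ 2) := by
      intro ω
      rw [norm_mul, mul_pow, Complex.norm_real, Real.norm_eq_abs, sq_abs,
        ENNReal.ofReal_mul (sq_nonneg _)]
    simp_rw [h2]
    rw [lintegral_const_mul _ (by fun_prop),
      (measurePreserving_eval_infinitePi (fun _ : ℕ => complexGaussian 1) i).lintegral_comp
        (f := fun z : ℂ => ENNReal.ofReal (‖z‖ ^ 2)) (by fun_prop),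
      lintegral_norm_sq_complexGaussian_one]
  rw [lintegral_tsum fun i => Measurable.aemeasurable (by fun_prop)]
  simp_rw [h1]
  rw [ENNReal.tsum_mul_right, ← ENNReal.ofReal_tsum_of_nonneg (fun i => sq_nonneg _) ha,
    mul_comm 2, ENNReal.ofReal_mul (tsum_nonneg fun i => sq_nonneg _)]
  simp

theorem memℓp_two_of_tsum_lt_top {x : ℕ → ℂ} (h : ∑' i, ENNReal.ofReal (‖x i‖ ^ 2) ≠ ∞) :
    Memℓp x 2 := by
  rw [memℓp_two_iff]
  refine (ENNReal.summable_toReal h).congr fun i => ?_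
  rw [ENNReal.toReal_ofReal (sq_nonneg _)]

theorem ae_memℓp_scaled {a : ℕ → ℝ} (ha : Summable fun i => a i ^ 2) :
    ∀ᵐ ω ∂stdGaussianSeq, Memℓp (fun i => (a i : ℂ) * ω i) 2 := by
  have h := ae_lt_top (μ := stdGaussianSeq)
    (f := fun ω => ∑' i, ENNReal.ofReal (‖(a i : ℂ) * ω i‖ ^ 2))
    (Measurable.tsum fun i => by fun_prop)
    (by rw [lintegral_tsum_sq_mul_norm_sq ha]; exact ENNReal.ofReal_ne_top)
  filter_upwards [h] with ω hω
  exact memℓp_two_of_tsum_lt_top hω.ne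

/-- Chebyshev's inequality for the norm of `(aᵢ ωᵢ)ᵢ`, including its finiteness. -/
theorem stdGaussianSeq_norm_scaledSeq_le {a : ℕ → ℝ} (ha : Summable fun i => a i ^ 2) {r : ℝ}
    (hr : 0 < r) :
    stdGaussianSeq {ω | Memℓp (fun i => (a i : ℂ) * ω i) 2 ∧ ‖scaledSeq a ω‖ ≤ r}ᶜ ≤
      ENNReal.ofReal (2 * (∑' i, a i ^ 2) / r ^ 2) := by
  have h := meas_ge_le_lintegral_div (μ := stdGaussianSeq)
    (f := fun ω => ∑' i, ENNReal.ofReal (‖(a i : ℂ) * ω i‖ ^ 2))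
    (Measurable.tsum fun i => by fun_prop).aemeasurable (ε := ENNReal.ofReal (r ^ 2))
    (by simpa using hr.ne') ENNReal.ofReal_ne_top
  rw [lintegral_tsum_sq_mul_norm_sq ha, ← ENNReal.ofReal_div_of_pos (by positivity)] at h
  refine le_trans (measure_mono fun ω hω => ?_) h
  by_contra hlt
  simp only [Set.mem_ofPred_eq, not_le] at hlt
  have hmem := memℓp_two_of_tsum_lt_top hlt.ne_top
  refine hω ⟨hmem, ?_⟩
  have hn : ENNReal.ofReal (‖scaledSeq a ω‖ ^ 2) < ENNReal.ofReal (r ^ 2) := by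
    rw [norm_sq_eq_tsum, ENNReal.ofReal_tsum_of_nonneg (fun i => sq_nonneg _)
      (memℓp_two_iff.1 (scaledSeq a ω).2)]
    have := congrFun (coe_toSeq hmem)
    simp only at this
    simp only [scaledSeq, this]
    exact hlt
  have := (ENNReal.ofReal_lt_ofReal_iff (by positivity)).1 hn
  exact (lt_of_pow_lt_pow_left₀ 2 hr.le this).le

theorem map_scaledSeq {a : ℕ → ℝ} (ha : Summable fun i => a i ^ 2) :
    stdGaussianSeq.map (scaledSeq a) = gaussianMeasure a := by
  have h : stdGaussianSeq.map (fun ω i => (a i : ℂ) * ω i) =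
      Measure.infinitePi fun i => complexGaussian (a i) := by
    rw [stdGaussianSeq, Measure.infinitePi_map_pi _ (f := fun i z => (a i : ℂ) * z)
      fun i => by fun_prop]
    simp_rw [map_mul_complexGaussian_one]
  have h2 : (stdGaussianSeq.map (scaledSeq a)).map (fun (y : HilbertSeq) (i : ℕ) => y i) =
      Measure.infinitePi fun i => complexGaussian (a i) := by
    rw [← h, Measure.map_map measurableEmbedding_coe.measurable (measurable_scaledSeq a)]
    refine Measure.map_congr ?_
    filter_upwards [ae_memℓp_scaled ha] with ω hω
    exact coe_toSeq hω
  rw [gaussianMeasure, ← h2, measurableEmbedding_coe.comap_map]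

/-! ### The law of large numbers for the norm -/

theorem ae_tendsto_avg_norm_sq :
    ∀ᵐ ω ∂stdGaussianSeq,
      Tendsto (fun n : ℕ => (∑ i ∈ Finset.range n, ‖ω i‖ ^ 2) / n) atTop (𝓝 2) := by
  have hid : ∀ i, IdentDistrib (fun ω : ℕ → ℂ => ‖ω i‖ ^ 2) (fun ω => ‖ω 0‖ ^ 2)
      stdGaussianSeq stdGaussianSeq := by
    intro i
    have : IdentDistrib (fun ω : ℕ → ℂ => ω i) (fun ω => ω 0) stdGaussianSeq stdGaussianSeq :=
      ⟨(measurable_pi_apply i).aemeasurable, (measurable_pi_apply 0).aemeasurable,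
        (Measure.infinitePi_map_eval (fun _ : ℕ => complexGaussian 1) i).trans
          (Measure.infinitePi_map_eval (fun _ : ℕ => complexGaussian 1) 0).symm⟩
    exact this.comp (u := fun z : ℂ => ‖z‖ ^ 2) (by fun_prop)
  have hmp := measurePreserving_eval_infinitePi (fun _ : ℕ => complexGaussian 1) 0
  have h0 : ∫ ω, ‖ω 0‖ ^ 2 ∂stdGaussianSeq = 2 := by
    rw [← integral_norm_sq_complexGaussian_one, ← hmp.map_eq,
      integral_map hmp.measurable.aemeasurable (by fun_prop)]
  have hind := iIndepFun_infinitePi (P := fun _ : ℕ => complexGaussian 1)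
    (X := fun _ z => ‖z‖ ^ 2) fun i => by fun_prop
  have := strong_law_ae_real (μ := stdGaussianSeq) (fun i ω => ‖ω i‖ ^ 2)
    (hmp.integrable_comp_of_integrable integrable_norm_sq_complexGaussian_one)
    (fun i j hij => hind.indepFun hij) hid
  rwa [h0] at this

/-- The ratio between the radius `√(2 n)`, near which the standard Gaussian measure of `ℂⁿ`
concentrates, and the norm of the first `n` coordinates. -/
noncomputable def radiusRatio (n : ℕ) (ω : ℕ → ℂ) : ℝ :=
  √(2 * n) / √(∑ i ∈ Finset.range n, ‖ω i‖ ^ 2)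

theorem tendsto_measure_radiusRatio {η : ℝ} (hη : 0 < η) :
    Tendsto (fun n => stdGaussianSeq {ω | |radiusRatio n ω - 1| ≤ η}ᶜ) atTop (𝓝 0) := by
  have hm : ∀ n, Measurable (radiusRatio n) := fun n => by
    unfold radiusRatio
    fun_prop
  have hae : ∀ᵐ ω ∂stdGaussianSeq, Tendsto (fun n => radiusRatio n ω) atTop (𝓝 1) := by
    filter_upwards [ae_tendsto_avg_norm_sq] with ω hω
    have h1 : Tendsto (fun n : ℕ => √2 / √((∑ i ∈ Finset.range n, ‖ω i‖ ^ 2) / n)) atTop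
        (𝓝 (√2 / √2)) := tendsto_const_nhds.div hω.sqrt (by positivity)
    rw [div_self (by positivity)] at h1
    refine h1.congr' ?_
    filter_upwards [eventually_gt_atTop 0] with n hn
    have hn' : (0 : ℝ) < √n := Real.sqrt_pos.2 (by exact_mod_cast hn)
    rw [radiusRatio, Real.sqrt_mul (by norm_num), Real.sqrt_div' _ (by positivity)]
    field_simp
  have h := tendstoInMeasure_iff_norm.1 (tendstoInMeasure_of_tendsto_ae
    (fun n => (hm n).aestronglyMeasurable) hae) η hη
  refine tendsto_of_tendsto_of_tendsto_of_le_of_le tendsto_const_nhds h (fun _ => zero_le)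
    fun n => measure_mono fun ω hω => ?_
  simp only [Set.mem_compl_iff, Set.mem_ofPred_eq, not_le] at hω
  exact hω.le

/-! ### Random points of ellipsoids -/

section Ellipsoid

variable {n : ℕ} {α : Fin n → ℝ}

instance : SecondCountableTopology (Ellipsoid α) :=
  inferInstanceAs (SecondCountableTopology
    {z : EuclideanSpace ℂ (Fin n) // ∑ i, ‖z i‖ ^ 2 / α i ^ 2 = 1})

theorem continuous_ellipsoidMap (hα : ∀ i, 0 < α i) : Continuous (ellipsoidMap hα) := by
  refine continuous_induced_rng.2 ?_
  change Continuous fun z : Metric.sphere (0 : EuclideanSpace ℂ (Fin n)) 1 =>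
    (WithLp.toLp 2 fun i => (α i : ℂ) * z.1 i : EuclideanSpace ℂ (Fin n))
  fun_prop

/-- The point of the ellipsoid over the direction of the first `n` coordinates of `ω`. -/
noncomputable def ellipsoidPoint (hα : ∀ i, 0 < α i)
    (e : Metric.sphere (0 : EuclideanSpace ℂ (Fin n)) 1) (ω : ℕ → ℂ) : Ellipsoid α :=
  ellipsoidMap hα (direction e (WithLp.toLp 2 fun i : Fin n => ω i))

theorem measurable_ellipsoidPoint (hα : ∀ i, 0 < α i)
    (e : Metric.sphere (0 : EuclideanSpace ℂ (Fin n)) 1) : Measurable (ellipsoidPoint hα e) :=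
  (continuous_ellipsoidMap hα).measurable.comp ((measurable_direction e).comp (by fun_prop))

theorem map_ellipsoidPoint (hα : ∀ i, 0 < α i)
    (e : Metric.sphere (0 : EuclideanSpace ℂ (Fin n)) 1) :
    stdGaussianSeq.map (ellipsoidPoint hα e) = ellipsoidMeasure hα := by
  have h := Measure.map_infinitePi_infinitePi_of_inj (P := fun _ : ℕ => complexGaussian 1)
    (Fin.val_injective (n := n))
  rw [Measure.infinitePi_eq_pi (ι := Fin n)] at h
  have hd : Measurable fun z : Fin n → ℂ => direction e (WithLp.toLp 2 z) :=
    (measurable_direction e).comp (by fun_prop)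
  rw [ellipsoidMeasure, ← map_direction_pi_complexGaussian e, ← h,
    Measure.map_map hd (by fun_prop),
    Measure.map_map (continuous_ellipsoidMap hα).measurable (hd.comp (by fun_prop))]
  rfl

/-- The inclusion of an ellipsoid into `ℓ²`. -/
noncomputable def ellipsoidInclusion (x : Ellipsoid α) : HilbertSeq := extendSeq x.1

theorem isometry_ellipsoidInclusion : Isometry (ellipsoidInclusion (α := α)) :=
  isometry_extendSeq.comp isometry_subtype_coe

theorem ellipsoidInclusion_smul (c : Circle) (x : Ellipsoid α) :
    ellipsoidInclusion (c • x) = c • ellipsoidInclusion x :=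
  extendSeq_smul (c : ℂ) x.1

/-- The normalized semi-axes `αᵢ / √(2 n)`, extended by zero to a sequence. -/
noncomputable def normalizedAxes (α : Fin n → ℝ) (i : ℕ) : ℝ :=
  if h : i < n then α ⟨i, h⟩ / √(2 * n) else 0

theorem normalizedAxes_eq_zero {i : ℕ} (hi : i ∉ Finset.range n) :
    normalizedAxes α i = 0 := by
  rw [normalizedAxes, dif_neg (Finset.mem_range.not.1 hi)]

theorem memℓp_normalizedAxes_mul (ω : ℕ → ℂ) :
    Memℓp (fun i => (normalizedAxes α i : ℂ) * ω i) 2 :=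
  memℓp_two_iff.2 <| summable_of_ne_finset_zero (s := Finset.range n) fun i hi => by
    simp [normalizedAxes_eq_zero hi]

/-- The random point of the ellipsoid is a multiple, with factor close to `1`, of a random sequence
with Gaussian coordinates of standard deviations `αᵢ / √(2 n)`. -/
theorem ellipsoidInclusion_ellipsoidPoint (hα : ∀ i, 0 < α i)
    (e : Metric.sphere (0 : EuclideanSpace ℂ (Fin n)) 1) {ω : ℕ → ℂ}
    (hω : radiusRatio n ω ≠ 0) :
    ellipsoidInclusion (ellipsoidPoint hα e ω) =
      (radiusRatio n ω : ℂ) • scaledSeq (normalizedAxes α) ω := by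
  set x : EuclideanSpace ℂ (Fin n) := WithLp.toLp 2 fun i : Fin n => ω i with hx
  have hnorm : ‖x‖ = √(∑ i ∈ Finset.range n, ‖ω i‖ ^ 2) := by
    rw [EuclideanSpace.norm_eq, Finset.sum_range]
  obtain ⟨h2n, hs⟩ := div_ne_zero_iff.1 hω
  have hx0 : x ≠ 0 := by
    rw [← norm_ne_zero_iff, hnorm]
    exact hs
  ext i
  have h2 : scaledSeq (normalizedAxes α) ω i = (normalizedAxes α i : ℂ) * ω i :=
    congrFun (coe_toSeq (memℓp_normalizedAxes_mul ω)) i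
  change extendSeq _ i = (radiusRatio n ω : ℂ) • scaledSeq (normalizedAxes α) ω i
  rw [h2, extendSeq_apply, normalizedAxes]
  split_ifs with h
  · change (α ⟨i, h⟩ : ℂ) * (direction e x : EuclideanSpace ℂ (Fin n)) ⟨i, h⟩ = _
    rw [coe_direction e hx0, hnorm, radiusRatio]
    have h2n' : ((√(2 * n) : ℝ) : ℂ) ≠ 0 := by exact_mod_cast h2n
    have hs' : ((√(∑ i ∈ Finset.range n, ‖ω i‖ ^ 2) : ℝ) : ℂ) ≠ 0 := by exact_mod_cast hs
    simp only [PiLp.smul_apply, hx, Complex.real_smul, smul_eq_mul, Complex.ofReal_div,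
      Complex.ofReal_inv]
    field_simp
  · simp

theorem hasSum_sq_sub_normalizedAxes {a : ℕ → ℝ} (ha : Summable fun i => a i ^ 2) :
    HasSum (fun i => (a i - normalizedAxes α i) ^ 2)
      (∑ i : Fin n, (α i / √(2 * (n : ℝ)) - a i) ^ 2 + ∑' i, a (i + n) ^ 2) := by
  have h := ((summable_nat_add_iff n).2 ha).hasSum
  rw [hasSum_nat_add_iff' n |>.symm]
  have h1 : ∑ i ∈ Finset.range n, (a i - normalizedAxes α i) ^ 2 =
      ∑ i : Fin n, (α i / √(2 * (n : ℝ)) - a i) ^ 2 := by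
    rw [Finset.sum_range]
    refine Finset.sum_congr rfl fun i _ => ?_
    rw [normalizedAxes, dif_pos i.2, Fin.eta]
    ring
  rw [h1, add_sub_cancel_left]
  refine h.congr_fun fun i => ?_
  simp [normalizedAxes]

/-- The deterministic estimate: the two random points are close as soon as `radiusRatio n ω` is
close to `1` and the Gaussian sequences with parameters `a` and `normalizedAxes α` are close. -/
theorem dist_ellipsoidPoint_scaledSeq_le (hα : ∀ i, 0 < α i)
    (e : Metric.sphere (0 : EuclideanSpace ℂ (Fin n)) 1) {a : ℕ → ℝ} {ω : ℕ → ℂ} {η R : ℝ}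
    (hη : η ≤ 1 / 2) (h1 : |radiusRatio n ω - 1| ≤ η)
    (h2 : Memℓp (fun i => ((a i - normalizedAxes α i : ℝ) : ℂ) * ω i) 2)
    (h3 : ‖scaledSeq (fun i => a i - normalizedAxes α i) ω‖ ≤ η)
    (h4 : ‖scaledSeq a ω‖ ≤ R) :
    dist (ellipsoidInclusion (ellipsoidPoint hα e ω)) (scaledSeq a ω) ≤ η * (2 + R) := by
  have hη0 : 0 ≤ η := (abs_nonneg _).trans h1
  have hr := abs_le.1 h1
  -- In particular the direction of `ω` is defined: otherwise the ratio would be `x / 0 = 0`.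
  have hr0 : radiusRatio n ω ≠ 0 := by
    intro h
    rw [h] at hr
    linarith
  rw [ellipsoidInclusion_ellipsoidPoint hα e hr0, dist_eq_norm]
  set w := scaledSeq (normalizedAxes α) ω
  set v := scaledSeq a ω with hv
  have hsub : scaledSeq (fun i => a i - normalizedAxes α i) ω = v - w := by
    have hw := memℓp_normalizedAxes_mul (α := α) ω
    have ha : Memℓp (fun i => (a i : ℂ) * ω i) 2 := by
      convert h2.add hw using 1
      funext i
      simp only [Pi.add_apply]
      push_cast
      ring
    ext i
    have e1 := congrFun (coe_toSeq h2) i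
    have e2 := congrFun (coe_toSeq ha) i
    have e3 := congrFun (coe_toSeq hw) i
    simp only at e1 e2 e3
    simp only [lp.coeFn_sub, Pi.sub_apply, scaledSeq, w, v, e1, e2, e3]
    push_cast
    ring
  rw [hsub] at h3
  have hdec : (radiusRatio n ω : ℂ) • w - v =
      ((radiusRatio n ω - 1 : ℝ) : ℂ) • v - (radiusRatio n ω : ℂ) • (v - w) := by
    rw [smul_sub, Complex.ofReal_sub, sub_smul, Complex.ofReal_one, one_smul]
    abel
  calc ‖(radiusRatio n ω : ℂ) • w - v‖
      ≤ |radiusRatio n ω - 1| * ‖v‖ + |radiusRatio n ω| * ‖v - w‖ := by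
        rw [hdec]
        refine (norm_sub_le _ _).trans_eq ?_
        rw [norm_smul, norm_smul, Complex.norm_real, Complex.norm_real, Real.norm_eq_abs,
          Real.norm_eq_abs]
    _ ≤ η * R + 2 * η := by
        gcongr
        rw [abs_le]
        constructor <;> linarith
    _ = η * (2 + R) := by ring

end Ellipsoid

/-! ### Convergence -/

/-- The random points of the ellipsoids and of `ℓ²` become close in probability, on a ball of `ℓ²`
of large measure. Since `‖v ω‖ ≤ R` is what bounds the displacement of `v ω` by a small rotation,
`R` is chosen before the precision `η`. -/
theorem exists_radius_eventually_measure_le (n : ℕ+ → ℕ) (hn : Tendsto n atTop atTop)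
    (α : (j : ℕ+) → Fin (n j) → ℝ) (a : ℕ → ℝ) (ha : Summable fun i => a i ^ 2)
    (hlim : Tendsto
      (fun j => ∑ i : Fin (n j), (α j i / √(2 * (n j : ℝ)) - a i) ^ 2) atTop (𝓝 0))
    {ε : ℝ} (hε : 0 < ε) :
    ∃ R : ℝ, 0 < R ∧ ∀ η : ℝ, 0 < η → η ≤ 1 / 2 → ∀ᶠ j in atTop,
      ∀ (hα : ∀ i, 0 < α j i) (e : Metric.sphere (0 : EuclideanSpace ℂ (Fin (n j))) 1),
        stdGaussianSeq {ω | dist (ellipsoidInclusion (ellipsoidPoint hα e ω)) (scaledSeq a ω) ≤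
          η * (2 + R) ∧ ‖scaledSeq a ω‖ ≤ R}ᶜ ≤ ENNReal.ofReal ε := by
  set A := ∑' i, a i ^ 2 with hA
  have hA0 : 0 ≤ A := tsum_nonneg fun i => sq_nonneg _
  -- The radius is large enough for Chebyshev's inequality to give a probability of at most `ε / 3`.
  set R : ℝ := √(6 * A / ε + 1) with hR
  have hRpos : 0 < R := Real.sqrt_pos.2 (by positivity)
  have hRsq : R ^ 2 = 6 * A / ε + 1 := Real.sq_sqrt (by positivity)
  refine ⟨R, hRpos, fun η hη hη2 => ?_⟩
  have hsum : Tendsto (fun j => ∑ i : Fin (n j), (α j i / √(2 * (n j : ℝ)) - a i) ^ 2 +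
      ∑' i, a (i + n j) ^ 2) atTop (𝓝 0) := by
    simpa using hlim.add ((tendsto_sum_nat_add fun i => a i ^ 2).comp hn)
  have hev1 := hsum.eventually_lt_const (show (0 : ℝ) < ε * η ^ 2 / 6 by positivity)
  have hev2 := ((tendsto_measure_radiusRatio hη).comp hn).eventually_lt_const
    (show (0 : ℝ≥0∞) < ENNReal.ofReal (ε / 3) from ENNReal.ofReal_pos.2 (by positivity))
  filter_upwards [hev1, hev2] with j hj1 hj2 hα e
  -- Besides `R`, the event involves the radius and the difference of the two Gaussian sequences;
  -- each of the three conditions fails with probability at most `ε / 3`.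
  have hs := hasSum_sq_sub_normalizedAxes (α := α j) ha
  have hm1 : stdGaussianSeq {ω | Memℓp (fun i => (a i : ℂ) * ω i) 2 ∧ ‖scaledSeq a ω‖ ≤ R}ᶜ ≤
      ENNReal.ofReal (ε / 3) := by
    refine (stdGaussianSeq_norm_scaledSeq_le ha hRpos).trans (ENNReal.ofReal_le_ofReal ?_)
    rw [div_le_iff₀ (by positivity), hRsq]
    have : ε / 3 * (6 * A / ε + 1) = 2 * A + ε / 3 := by
      field_simp
      ring
    linarith
  have hm2 := stdGaussianSeq_norm_scaledSeq_le hs.summable hη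
  rw [hs.tsum_eq] at hm2
  replace hm2 := hm2.trans (ENNReal.ofReal_le_ofReal (q := ε / 3) (by
    rw [div_le_iff₀ (by positivity)]
    linarith))
  have hsub : {ω | dist (ellipsoidInclusion (ellipsoidPoint hα e ω)) (scaledSeq a ω) ≤
      η * (2 + R) ∧ ‖scaledSeq a ω‖ ≤ R}ᶜ ⊆
      {ω | |radiusRatio (n j) ω - 1| ≤ η}ᶜ ∪
      ({ω | Memℓp (fun i => (a i : ℂ) * ω i) 2 ∧ ‖scaledSeq a ω‖ ≤ R}ᶜ ∪
      {ω | Memℓp (fun i => ((a i - normalizedAxes (α j) i : ℝ) : ℂ) * ω i) 2 ∧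
        ‖scaledSeq (fun i => a i - normalizedAxes (α j) i) ω‖ ≤ η}ᶜ) := by
    rw [← Set.compl_inter, ← Set.compl_inter, Set.compl_subset_compl]
    rintro ω ⟨h1, ⟨-, h2⟩, h3, h4⟩
    exact ⟨dist_ellipsoidPoint_scaledSeq_le hα e hη2 h1 h3 h4 h2, h2⟩
  calc _ ≤ ENNReal.ofReal (ε / 3) + (ENNReal.ofReal (ε / 3) + ENNReal.ofReal (ε / 3)) :=
        (measure_mono hsub).trans <| (measure_union_le _ _).trans <|
          add_le_add hj2.le <| (measure_union_le _ _).trans <| add_le_add hm1 hm2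
    _ = ENNReal.ofReal ε := by
      rw [← ENNReal.ofReal_add (by positivity) (by positivity),
        ← ENNReal.ofReal_add (by positivity) (by positivity)]
      congr 1
      ring

/-- The estimate behind both convergence statements: for large `j` the random points of the
ellipsoid and of `ℓ²` and the groups `ℤ/jℤ` and `U(1)` satisfy the hypotheses of
`eqBoxDist_map_le` and `boxDist_orbitMeasure_map_le`, so one coupling serves for both. -/
theorem eventually_eqBoxDist_and_boxDist_le (n : ℕ+ → ℕ) (hn : Tendsto n atTop atTop)
    (α : (j : ℕ+) → Fin (n j) → ℝ) (hα : ∀ j i, 0 < α j i)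
    (a : ℕ → ℝ) (ha : Summable fun i => a i ^ 2)
    (hlim : Tendsto
      (fun j => ∑ i : Fin (n j), (α j i / √(2 * (n j : ℝ)) - a i) ^ 2) atTop (𝓝 0))
    {ε : ℝ} (hε : 0 < ε) :
    ∀ᶠ j : ℕ+ in atTop,
      eqBoxDist (ellipsoidMeasure (hα j)) (actionMaps (cyclicSubgroup j) (Ellipsoid (α j)))
        (gaussianMeasure a) (actionMaps Circle HilbertSeq) ≤ ENNReal.ofReal ε ∧
      boxDist (orbitMeasure (cyclicSubgroup j) (ellipsoidMeasure (hα j)))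
        (orbitMeasure Circle (gaussianMeasure a)) ≤ ENNReal.ofReal ε := by
  obtain ⟨R, hR, hP⟩ := exists_radius_eventually_measure_le n hn α a ha hlim hε
  -- `ε` is split into two equal parts, for the distance of the points and for the distance of
  -- the groups.
  set η : ℝ := min (1 / 2) (ε / 4 / (2 + R)) with hη
  have hη0 : 0 < η := by positivity
  set δ : ℝ := ε / (2 * R) with hδ
  have hδ0 : 0 < δ := by positivity
  have htotal : 2 * (ε / 4) + δ * R = ε := by
    rw [hδ]
    field_simp
    ring
  have hηR : η * (2 + R) ≤ ε / 4 := by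
    rw [← le_div_iff₀ (by positivity)]
    exact min_le_right _ _
  have hj : Tendsto (fun j : ℕ+ => 2 * Real.pi / ((j : ℕ) : ℝ)) atTop (𝓝 0) :=
    tendsto_const_nhds.div_atTop (tendsto_natCast_atTop_atTop.comp tendsto_PNat_val_atTop_atTop)
  filter_upwards [hP η hη0 (min_le_left _ _), hj.eventually_le_const hδ0,
    hn.eventually_gt_atTop 0] with j hPj hδj hnj
  have : Nonempty (Fin (n j)) := ⟨⟨0, hnj⟩⟩
  have hnt : Nontrivial (EuclideanSpace ℂ (Fin (n j))) := inferInstance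
  obtain ⟨e⟩ : Nonempty (Metric.sphere (0 : EuclideanSpace ℂ (Fin (n j))) 1) :=
    (NormedSpace.sphere_nonempty (E := EuclideanSpace ℂ (Fin (n j)))).2 zero_le_one |>.to_subtype
  have hK : ∀ c : Circle, ∃ k ∈ cyclicSubgroup j, ‖(k : ℂ) - c‖ ≤ δ := fun c => by
    obtain ⟨k, hk, hkc⟩ := exists_mem_cyclicSubgroup_norm_sub_le j c
    exact ⟨k, hk, hkc.trans hδj⟩
  have hP' : stdGaussianSeq {ω | dist (ellipsoidInclusion (ellipsoidPoint (hα j) e ω))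
      (scaledSeq a ω) ≤ ε / 4 ∧ ‖scaledSeq a ω‖ ≤ R}ᶜ ≤
        ENNReal.ofReal (2 * (ε / 4) + δ * R) := by
    rw [htotal]
    refine le_trans (measure_mono ?_) (hPj (hα j) e)
    exact Set.compl_subset_compl.2 fun ω hω => ⟨hω.1.trans hηR, hω.2⟩
  have h1 := eqBoxDist_map_le (measurable_ellipsoidPoint (hα j) e).aemeasurable
    (measurable_scaledSeq a).aemeasurable isometry_ellipsoidInclusion ellipsoidInclusion_smul hK hP'
  have h2 := boxDist_orbitMeasure_map_le (measurable_ellipsoidPoint (hα j) e).aemeasurable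
    (measurable_scaledSeq a).aemeasurable isometry_ellipsoidInclusion ellipsoidInclusion_smul hK hP'
  rw [map_ellipsoidPoint, map_scaledSeq ha, htotal] at h1 h2
  exact ⟨h1, h2⟩

theorem tendsto_zero_of_eventually_le_ofReal {ι : Type*} {l : Filter ι} {f : ι → ℝ≥0∞}
    (h : ∀ ε : ℝ, 0 < ε → ∀ᶠ i in l, f i ≤ ENNReal.ofReal ε) : Tendsto f l (𝓝 0) := by
  refine ENNReal.tendsto_nhds_zero.2 fun ε hε => ?_
  rcases eq_or_ne ε ∞ with rfl | hε'
  · exact Eventually.of_forall fun _ => le_top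
  · filter_upwards [h ε.toReal (ENNReal.toReal_pos hε.ne' hε')] with i hi
    rwa [ENNReal.ofReal_toReal hε'] at hi

theorem mainTheorem6 (n : ℕ+ → ℕ) (hn : Tendsto n atTop atTop)
    (α : (j : ℕ+) → Fin (n j) → ℝ) (hα : ∀ j i, 0 < α j i)
    (a : ℕ → ℝ) (ha : Summable fun i => a i ^ 2)
    (hlim : Tendsto
      (fun j => ∑ i : Fin (n j), (α j i / √(2 * (n j : ℝ)) - a i) ^ 2) atTop (𝓝 0)) :
    Tendsto
      (fun j : ℕ+ => eqBoxDist
        (ellipsoidMeasure (hα j)) (actionMaps (cyclicSubgroup j) (Ellipsoid (α j)))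
        (gaussianMeasure a) (actionMaps Circle HilbertSeq))
      atTop (𝓝 0) ∧
    Tendsto
      (fun j : ℕ+ => boxDist
        (orbitMeasure (cyclicSubgroup j) (ellipsoidMeasure (hα j)))
        (orbitMeasure Circle (gaussianMeasure a)))
      atTop (𝓝 0) ∧
    ∃ q : ℝ≥0 × Projectivization ℂ HilbertSeq → OrbitSpace Circle HilbertSeq,
      IsEuclideanCone fubiniStudyDist q := by
  refine ⟨tendsto_zero_of_eventually_le_ofReal fun ε hε => ?_,
    tendsto_zero_of_eventually_le_ofReal fun ε hε => ?_, coneMap, isEuclideanCone_coneMap⟩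
  · exact (eventually_eqBoxDist_and_boxDist_le n hn α hα a ha hlim hε).mono fun j hj => hj.1
  · exact (eventually_eqBoxDist_and_boxDist_le n hn α hα a ha hlim hε).mono fun j hj => hj.2
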